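/- **Proposition 3.5.** Let $\mathfrak g$ be a finite-dimensional simple complex Lie algebra with Cartan subalgebra $\mathfrak h$, root system $\Delta$ and normalized Killing form $\langle\cdot,\cdot\rangle$ (the multiple of the Killing form for which long roots have squared length $2$), and let $r$ be a positive integer. Let $$\tau=(\mathfrak g\otimes\mathbb C[t_0^{\pm1}]\oplus\mathbb CK_0)\otimes\mathbb C[t_1^{\pm1},\dots,t_r^{\pm1}]\oplus\sum_{i=1}^r\mathbb CK_i$$ be the toroidal Lie algebra in which, with $a(n_0,\underline n)=a\otimes t_0^{n_0}t_1^{n_1}\cdots t_r^{n_r}$ and $K_0(\underline n)=K_0\otimes t_1^{n_1}\cdots t_r^{n_r}$ for $a\in\mathfrak g$, $n_0\in\mathbb Z$, $\underline n\in\mathbb Z^r$, all $K_0(\underline n)$ and $K_1,\dots,K_r$ are central and $$[a(n_0,\underline n),b(m_0,\underline m)]=[a,b](n_0+m_0,\underline n+\underline m)+n_0\langle a,b\rangle\delta_{n_0+m_0,0}K_0(\underline n+\underline m)+\langle a,b\rangle\delta_{n_0+m_0,0}\delta_{\underline n+\underline m,0}\sum_{i=1}^r n_iK_i .$$ A $\tau$-module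 $W$ is *integrable* if (i) $W$ is the direct sum of the weight spaces $W_\lambda=\{w\in W: hw=\lambda(h)w\ \text{for all } h\in\underline{\mathfrak h}\}$, where $\underline{\mathfrak h}$ is the linear span of $\mathfrak h$, all $K_0(\underline n)$ and $K_1,\dots,K_r$, and $\lambda$ runs over $\underline{\mathfrak h}^*$; and (ii) for every root $\alpha\in\Delta$ with root vector $x_\alpha$, all $(m_0,\underline m)\in\mathbb Z^{r+1}$ and every $w\in W$ there is $k\ge 0$ with $x_\alpha(m_0,\underline m)^kw=0$. A $\tau$-module $W$ belongs to the *category $\mathcal E_\tau$* if there are nonzero polynomials $p_0,\dots,p_r\in\mathbb C[x]$ such that $p_i(x_i)\,a(x_0,\underline x)w=0$ for all $i=0,\dots,r$, $a\in\mathfrak g$ and $w\in W$, where $a(x_0,\underline x)=\sum_{n_0,\underline n}a(n_0,\underline n)\,x_0^{-n_0-1}x_1^{-n_1-1}\cdots x_r^{-n_r-1}$. For $s\geq 1$, $\mathfrak g$-modules $U_1,\dots,U_s$ and $\underline z_j=(z_{0j},\dots,z_{rj})\in(\mathbb C^*)^{r+1}$, the *evaluation module* $U_1(\underline z_1)\otimes\cdots\otimes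 U_s(\underline z_s)$ is the space $U_1\otimes\cdots\otimes U_s$ on which all $K_0(\underline n)$ and $K_i$ act by zero and $$a(n_0,\underline n)(u_1\otimes\cdots\otimes u_s)=\sum_{j=1}^s z_{0j}^{n_0}\cdots z_{rj}^{n_r}\,(u_1\otimes\cdots\otimes au_j\otimes\cdots\otimes u_s).$$ Then a $\tau$-module $W$ is irreducible, integrable and in the category $\mathcal E_\tau$ if and only if it is isomorphic to an evaluation module $U_1(\underline z_1)\otimes\cdots\otimes U_s(\underline z_s)$ for some $s\ge 1$, some finite-dimensional irreducible $\mathfrak g$-modules $U_1,\dots,U_s$ and some pairwise distinct $\underline z_1,\dots,\underline z_s\in(\mathbb C^*)^{r+1}$. -/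

import Mathlib

open scoped TensorProduct

universe v

noncomputable section

namespace ToroidalLie

/-! ### The toroidal Lie algebra -/

/-- Multi-indices `(n₀, n₁, …, n_r)`; the coordinate `0` plays a special role. -/
abbrev Idx (r : ℕ) : Type := Fin (r + 1) → ℤ

/-- The centre of the extension: `K₀ ⊗ ℂ[t₁^{±1}, …, t_r^{±1}] ⊕ ℂ K₁ ⊕ ⋯ ⊕ ℂ K_r`. -/
abbrev Center (r : ℕ) : Type := AddMonoidAlgebra ℂ (Fin r → ℤ) × (Fin r → ℂ)

/-- The element `n₀ δ_{n₀+m₀,0} K₀(n₁+m₁, …, n_r+m_r) + δ_{n+m,0} ∑ᵢ nᵢ Kᵢ` of the centre. -/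
def centralTerm {r : ℕ} (n m : Idx r) : Center r :=
  (if n 0 + m 0 = 0 then
      AddMonoidAlgebra.single (fun i : Fin r => n i.succ + m i.succ) ((n 0 : ℤ) : ℂ) else 0,
    if n + m = 0 then (fun i : Fin r => ((n i.succ : ℤ) : ℂ)) else 0)

lemma centralTerm_skew {r : ℕ} (n m : Idx r) : centralTerm n m = - centralTerm m n := by
  have e : (fun i : Fin r => n i.succ + m i.succ) = fun i : Fin r => m i.succ + n i.succ := by
    funext i; exact add_comm _ _
  refine Prod.ext ?_ ?_
  · simp only [centralTerm, Prod.fst_neg, e, add_comm (m 0) (n 0)]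
    split_ifs with h
    · have : n 0 = - m 0 := by omega
      rw [this, ← AddMonoidAlgebra.single_neg]; simp
    · simp
  · simp only [centralTerm, Prod.snd_neg, add_comm m n]
    split_ifs with h
    · funext i
      have : n i.succ + m i.succ = 0 := congrFun h i.succ
      have : n i.succ = - m i.succ := by omega
      simp [this]
    · simp

lemma centralTerm_cyclic {r : ℕ} (n m l : Idx r) :
    centralTerm n (m + l) = centralTerm (n + m) l - centralTerm m (n + l) := by
  have e : (fun i : Fin r => n i.succ + (m + l) i.succ) =
      fun i : Fin r => (n + m) i.succ + l i.succ := by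
    funext i; exact (add_assoc _ _ _).symm
  have e' : (fun i : Fin r => m i.succ + (n + l) i.succ) =
      fun i : Fin r => (n + m) i.succ + l i.succ := by
    funext i; simp only [Pi.add_apply]; ring
  have h1 : n 0 + (m + l) 0 = (n + m) 0 + l 0 := by simp only [Pi.add_apply]; ring
  have h2 : m 0 + (n + l) 0 = (n + m) 0 + l 0 := by simp only [Pi.add_apply]; ring
  have h3 : m + (n + l) = n + m + l := by abel
  refine Prod.ext ?_ ?_
  · simp only [centralTerm, Prod.fst_sub, e, e', h1, h2]
    split_ifs with h
    · rw [← AddMonoidAlgebra.single_sub]; simp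
    · simp
  · simp only [centralTerm, Prod.snd_sub, h3, ← add_assoc n m l]
    split_ifs with h
    · funext i; simp
    · simp

/-- The bilinear map on Laurent polynomials with `(t^n, t^m) ↦ centralTerm n m`. -/
def centralForm (r : ℕ) :
    AddMonoidAlgebra ℂ (Idx r) →ₗ[ℂ] AddMonoidAlgebra ℂ (Idx r) →ₗ[ℂ] Center r :=
  (AddMonoidAlgebra.basis (Idx r) ℂ).constr ℂ fun n =>
    (AddMonoidAlgebra.basis (Idx r) ℂ).constr ℂ fun m => centralTerm n m

lemma centralForm_single (r : ℕ) (n m : Idx r) :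
    centralForm r (AddMonoidAlgebra.single n 1) (AddMonoidAlgebra.single m 1) =
      centralTerm n m := by
  simp [centralForm, ← AddMonoidAlgebra.basis_apply, Module.Basis.constr_basis]

/-- The element `a(n) = t^n ⊗ a` of the multi-loop algebra. -/
def monomial {g : Type*} [LieRing g] [LieAlgebra ℂ g] {r : ℕ} (n : Idx r) (a : g) :
    LieAlgebra.loopAlgebra ℂ (Idx r) g :=
  AddMonoidAlgebra.single n 1 ⊗ₜ[ℂ] a

lemma monomial_lie {g : Type*} [LieRing g] [LieAlgebra ℂ g] {r : ℕ} (n m : Idx r) (a b : g) :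
    ⁅monomial n a, monomial m b⁆ = monomial (n + m) ⁅a, b⁆ := by
  simp [monomial, LieAlgebra.ExtendScalars.bracket_tmul, AddMonoidAlgebra.single_mul_single]

lemma loop_induction {g : Type*} [LieRing g] [LieAlgebra ℂ g] {r : ℕ} {P : LieAlgebra.loopAlgebra ℂ (Idx r) g → Prop}
    (h : ∀ (n : Idx r) (a : g), P (monomial n a))
    (hadd : ∀ x y, P x → P y → P (x + y)) (hsmul : ∀ (c : ℂ) x, P x → P (c • x))
    (x : LieAlgebra.loopAlgebra ℂ (Idx r) g) : P x := by
  induction x using TensorProduct.induction_on with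
  | zero => simpa [monomial] using hsmul 0 _ (h 0 0)
  | add x y hx hy => exact hadd x y hx hy
  | tmul f a =>
    induction f using AddMonoidAlgebra.induction_linear with
    | zero => simpa [monomial] using h 0 0
    | add u v hu hv => rw [TensorProduct.add_tmul]; exact hadd _ _ hu hv
    | single n c =>
      have e : (AddMonoidAlgebra.single n c : AddMonoidAlgebra ℂ (Idx r)) =
          c • AddMonoidAlgebra.single n 1 := by simp
      rw [e, ← TensorProduct.smul_tmul']
      exact hsmul _ _ (h n a)

lemma span_monomial {g : Type*} [LieRing g] [LieAlgebra ℂ g] {r : ℕ} :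
    Submodule.span ℂ {x : LieAlgebra.loopAlgebra ℂ (Idx r) g | ∃ n a, monomial n a = x} = ⊤ :=
  Submodule.eq_top_iff'.mpr fun x => loop_induction
    (P := fun x => x ∈ Submodule.span ℂ {x | ∃ n a, monomial n a = x})
    (fun n a => Submodule.subset_span ⟨n, a, rfl⟩) (fun _ _ => Submodule.add_mem _)
    (fun c _ => Submodule.smul_mem _ c) x

lemma loop_ext {g : Type*} [LieRing g] [LieAlgebra ℂ g] {r : ℕ} {M : Type*} [AddCommGroup M] [Module ℂ M]
    {f f' : LieAlgebra.loopAlgebra ℂ (Idx r) g →ₗ[ℂ] M}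
    (h : ∀ (n : Idx r) (a : g), f (monomial n a) =
      f' (monomial n a)) : f = f' := by
  apply TensorProduct.ext
  refine (AddMonoidAlgebra.basis (Idx r) ℂ).ext fun n => LinearMap.ext fun a => ?_
  simpa [AddMonoidAlgebra.basis_apply, monomial] using h n a

variable {g : Type*} [LieRing g] [LieAlgebra ℂ g] [FiniteDimensional ℂ g]
  [LieAlgebra.IsSimple ℂ g]

/-! ### The normalized Killing form -/

/-- The maximal squared length `(α, α) = κ(t_α, t_α) = α(t_α)` of a root, for the form on the dual
of the Cartan subalgebra `H` induced by the Killing form `κ` (where `κ(t_α, h) = α(h)`). These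
numbers are positive reals and there are finitely many of them, and at least one. -/
def maxRootLength (H : LieSubalgebra ℂ g) [H.IsCartanSubalgebra] : ℝ :=
  ⨆ α : H.root, ((α : LieModule.Weight ℂ H g)
    ((LieAlgebra.IsKilling.cartanEquivDual H).symm
      (LieModule.Weight.toLinear ℂ H g (α : LieModule.Weight ℂ H g)))).re

/-- The normalized Killing form of `g`: the multiple of the Killing form for which the
long roots have squared length `2`. (Replacing `κ` by `c κ` divides the squared lengths of the
roots by `c`.) -/
def normalizedForm (H : LieSubalgebra ℂ g) [H.IsCartanSubalgebra] : LinearMap.BilinForm ℂ g :=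
  ((maxRootLength H / 2 : ℝ) : ℂ) • killingForm ℂ g

/-- The bilinear map `(f ⊗ a, h ⊗ b) ↦ ⟨a, b⟩ • centralForm f h`. -/
def cocycleMap (H : LieSubalgebra ℂ g) [H.IsCartanSubalgebra] (r : ℕ) :
    LieAlgebra.loopAlgebra ℂ (Idx r) g →ₗ[ℂ] LieAlgebra.loopAlgebra ℂ (Idx r) g →ₗ[ℂ] Center r :=
  (TensorProduct.map₂ (centralForm r) (normalizedForm H)).compr₂
    (TensorProduct.rid ℂ (Center r)).toLinearMap

lemma cocycleMap_tmul (H : LieSubalgebra ℂ g) [H.IsCartanSubalgebra] (r : ℕ) (n m : Idx r)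
    (a b : g) :
    cocycleMap H r (monomial n a) (monomial m b) =
      normalizedForm H a b • centralTerm n m := by
  simp [cocycleMap, centralForm_single, monomial]

lemma normalizedForm_symm (H : LieSubalgebra ℂ g) [H.IsCartanSubalgebra] (a b : g) :
    normalizedForm H a b = normalizedForm H b a := by
  simp only [normalizedForm, LinearMap.smul_apply, LieModule.traceForm_comm ℂ g g a b]

lemma normalizedForm_lie (H : LieSubalgebra ℂ g) [H.IsCartanSubalgebra] (a b c : g) :
    normalizedForm H ⁅a, b⁆ c = normalizedForm H a ⁅b, c⁆ := by
  simp only [normalizedForm, LinearMap.smul_apply, LieModule.traceForm_apply_lie_apply]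

lemma cocycleMap_skew (H : LieSubalgebra ℂ g) [H.IsCartanSubalgebra] (r : ℕ)
    (x y : LieAlgebra.loopAlgebra ℂ (Idx r) g) :
    cocycleMap H r x y = - cocycleMap H r y x := by
  have : cocycleMap H r = - (cocycleMap H r).flip := by
    refine loop_ext fun n a => loop_ext fun m b => ?_
    simp only [LinearMap.neg_apply, LinearMap.flip_apply, cocycleMap_tmul]
    rw [normalizedForm_symm H b a, centralTerm_skew m n, smul_neg, neg_neg]
  exact LinearMap.congr_fun₂ this x y

lemma cocycleMap_cyclic_tmul (H : LieSubalgebra ℂ g) [H.IsCartanSubalgebra] (r : ℕ)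
    (n m l : Idx r) (a b c : g) :
    cocycleMap H r (monomial n a) ⁅monomial m b, monomial l c⁆ =
      cocycleMap H r ⁅monomial n a, monomial m b⁆ (monomial l c) +
      cocycleMap H r (monomial m b) ⁅monomial n a, monomial l c⁆ := by
  have h1 : normalizedForm H b ⁅a, c⁆ = - normalizedForm H a ⁅b, c⁆ := by
    rw [← normalizedForm_lie, ← lie_skew, map_neg, LinearMap.neg_apply, normalizedForm_lie]
  rw [monomial_lie, monomial_lie, monomial_lie, cocycleMap_tmul, cocycleMap_tmul, cocycleMap_tmul]
  rw [normalizedForm_lie, h1, centralTerm_cyclic, smul_sub, neg_smul, sub_eq_add_neg]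

lemma cyclic_of_span {L M : Type*} [LieRing L] [LieAlgebra ℂ L] [AddCommGroup M] [Module ℂ M]
    (ψ : L →ₗ[ℂ] L →ₗ[ℂ] M) (S : Set L) (hS : Submodule.span ℂ S = ⊤)
    (h : ∀ x ∈ S, ∀ y ∈ S, ∀ z ∈ S, ψ x ⁅y, z⁆ = ψ ⁅x, y⁆ z + ψ y ⁅x, z⁆) (x y z : L) :
    ψ x ⁅y, z⁆ = ψ ⁅x, y⁆ z + ψ y ⁅x, z⁆ := by
  have hx : x ∈ Submodule.span ℂ S := hS ▸ Submodule.mem_top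
  have hy : y ∈ Submodule.span ℂ S := hS ▸ Submodule.mem_top
  have hz : z ∈ Submodule.span ℂ S := hS ▸ Submodule.mem_top
  induction hx using Submodule.span_induction with
  | zero => simp
  | add u v _ _ hu hv =>
    rw [add_lie, add_lie, map_add, map_add, map_add, LinearMap.add_apply,
      LinearMap.add_apply, hu, hv]; abel
  | smul c u _ hu =>
    rw [smul_lie, smul_lie, map_smul, map_smul, map_smul, LinearMap.smul_apply,
      LinearMap.smul_apply, hu, smul_add]
  | mem x hx =>
    induction hy using Submodule.span_induction with
    | zero => simp
    | add u v _ _ hu hv =>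
      rw [add_lie, lie_add, map_add, map_add, map_add, LinearMap.add_apply,
        LinearMap.add_apply, hu, hv]; abel
    | smul c u _ hu =>
      rw [smul_lie, lie_smul, map_smul, map_smul, map_smul, LinearMap.smul_apply,
        LinearMap.smul_apply, hu, smul_add]
    | mem y hy =>
      induction hz using Submodule.span_induction with
      | zero => simp
      | add u v _ _ hu hv => rw [lie_add, lie_add, map_add, map_add, map_add, hu, hv]; abel
      | smul c u _ hu => rw [lie_smul, lie_smul, map_smul, map_smul, map_smul, hu, smul_add]
      | mem z hz => exact h x hx y hy z hz

lemma cocycleMap_cyclic (H : LieSubalgebra ℂ g) [H.IsCartanSubalgebra] (r : ℕ)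
    (x y z : LieAlgebra.loopAlgebra ℂ (Idx r) g) :
    cocycleMap H r x ⁅y, z⁆ = cocycleMap H r ⁅x, y⁆ z + cocycleMap H r y ⁅x, z⁆ := by
  refine cyclic_of_span (cocycleMap H r) {x | ∃ n a, monomial n a = x} span_monomial ?_ x y z
  rintro _ ⟨n, a, rfl⟩ _ ⟨m, b, rfl⟩ _ ⟨l, c, rfl⟩
  exact cocycleMap_cyclic_tmul H r n m l a b c

/-- The 2-cocycle on `g ⊗ ℂ[t₀^{±1}, …, t_r^{±1}]`, with values in the centre as a trivial
module, which defines the toroidal Lie algebra. -/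
def cocycle (H : LieSubalgebra ℂ g) [H.IsCartanSubalgebra] (r : ℕ) :
    LieModule.Cohomology.twoCocycle ℂ (LieAlgebra.loopAlgebra ℂ (Idx r) g)
      (TrivialLieModule ℂ (LieAlgebra.loopAlgebra ℂ (Idx r) g) (Center r)) where
  val := ⟨(cocycleMap H r).compr₂ (TrivialLieModule.equiv ℂ _ _).symm.toLinearMap, by
    refine LieModule.Cohomology.mem_twoCochain_iff.mpr fun x => ?_
    have h := cocycleMap_skew H r x x
    have h0 : cocycleMap H r x x = 0 := by
      have h2 : (2 : ℂ) • cocycleMap H r x x = 0 := by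
        rw [two_smul]; nth_rewrite 1 [h]; exact neg_add_cancel _
      exact (smul_eq_zero.mp h2).resolve_left two_ne_zero
    simp [h0]⟩
  property := by
    refine (LieModule.Cohomology.mem_twoCocycle_iff_of_trivial ℂ _ _ _).mpr fun x y z => ?_
    exact congrArg (TrivialLieModule.equiv ℂ _ _).symm (cocycleMap_cyclic H r x y z)

/-- The toroidal Lie algebra
`τ = (g ⊗ ℂ[t₀^{±1}] ⊕ ℂ K₀) ⊗ ℂ[t₁^{±1}, …, t_r^{±1}] ⊕ ∑ᵢ ℂ Kᵢ`. As a vector space it is the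
product of `ℂ[t₀^{±1}, …, t_r^{±1}] ⊗ g` and the centre; the bracket of `(x, c)` and
`(y, d)` is `([x, y], cocycleMap x y)`. -/
abbrev Toroidal (H : LieSubalgebra ℂ g) [H.IsCartanSubalgebra] (r : ℕ) : Type _ :=
  LieAlgebra.ofTwoCocycle (cocycle H r)

variable {H : LieSubalgebra ℂ g} [H.IsCartanSubalgebra] {r : ℕ}

/-- The element `a(n₀, …, n_r) = a ⊗ t₀^{n₀} ⋯ t_r^{n_r}` of `τ`. -/
def elt (H : LieSubalgebra ℂ g) [H.IsCartanSubalgebra] {r : ℕ} (n : Idx r) (a : g) :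
    Toroidal H r :=
  LieAlgebra.ofProd (cocycle H r) (monomial n a, 0)

/-- The inclusion of the centre `⊕ₙ ℂ K₀(n) ⊕ ⊕ᵢ ℂ Kᵢ` in `τ`. -/
def centerIncl (H : LieSubalgebra ℂ g) [H.IsCartanSubalgebra] {r : ℕ} :
    Center r →ₗ[ℂ] Toroidal H r where
  toFun c := LieAlgebra.ofProd (cocycle H r) (0, (TrivialLieModule.equiv ℂ _ _).symm c)
  map_add' c d := by simp [← LieAlgebra.of_add]
  map_smul' c d := by simp [← LieAlgebra.of_smul]

/-- The element `K₀(n₁, …, n_r) = K₀ ⊗ t₁^{n₁} ⋯ t_r^{n_r}`. -/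
def K₀ (H : LieSubalgebra ℂ g) [H.IsCartanSubalgebra] {r : ℕ} (n : Fin r → ℤ) : Toroidal H r :=
  centerIncl H (AddMonoidAlgebra.single n 1, 0)

/-- The element `Kᵢ`, `1 ≤ i ≤ r` (with indices shifted by one). -/
def K (H : LieSubalgebra ℂ g) [H.IsCartanSubalgebra] {r : ℕ} (i : Fin r) : Toroidal H r :=
  centerIncl H (0, Pi.single i 1)

/-- The defining bracket relation of `τ`. -/
theorem elt_lie_elt (n m : Idx r) (a b : g) :
    ⁅elt H n a, elt H m b⁆ = elt H (n + m) ⁅a, b⁆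
      + (if n 0 + m 0 = 0 then ((n 0 : ℂ) * normalizedForm H a b) •
          K₀ H (fun i : Fin r => n i.succ + m i.succ) else 0)
      + (if n 0 + m 0 = 0 ∧ (∀ i : Fin r, n i.succ + m i.succ = 0) then
          normalizedForm H a b • ∑ i : Fin r, (n i.succ : ℂ) • K H i else 0) := by
  have key : ⁅elt H n a, elt H m b⁆ = elt H (n + m) ⁅a, b⁆ +
      centerIncl H (normalizedForm H a b • centralTerm n m) := by
    rw [← cocycleMap_tmul, elt, elt, LieAlgebra.bracket_ofTwoCocycle]
    have h := monomial_lie n m a b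
    refine congrArg (LieAlgebra.ofProd (cocycle H r)) (Prod.ext ?_ ?_)
    · exact h.trans (add_zero _).symm
    · change (cocycleMap H r (monomial n a) (monomial m b) : Center r) + 0 - 0 =
        0 + cocycleMap H r (monomial n a) (monomial m b)
      rw [add_zero, sub_zero, zero_add]
  have hz : (n + m = 0) ↔ (n 0 + m 0 = 0 ∧ ∀ i : Fin r, n i.succ + m i.succ = 0) := by
    rw [funext_iff, Fin.forall_fin_succ]; rfl
  have hc : centralTerm n m =
      (if n 0 + m 0 = 0 then ((n 0 : ℤ) : ℂ) •
        ((AddMonoidAlgebra.single (fun i : Fin r => n i.succ + m i.succ) 1, 0) : Center r) else 0)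
      + (if n + m = 0 then ∑ i : Fin r, ((n i.succ : ℤ) : ℂ) •
        ((0, Pi.single i 1) : Center r) else 0) := by
    refine Prod.ext ?_ ?_
    · simp only [centralTerm, Prod.fst_add]
      split_ifs <;> simp [Prod.fst_sum]
    · simp only [centralTerm, Prod.snd_add]
      split_ifs <;> ext i <;> simp [Prod.snd_sum, Finset.sum_apply, Pi.single_apply]
  rw [key, add_assoc, hc]
  congr 1
  simp only [hz, smul_add, map_add, map_smul]
  congr 1
  · split_ifs
    · rw [map_smul, smul_smul, mul_comm]; rfl
    · simp
  · split_ifs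
    · rw [map_sum]; simp only [map_smul]; rfl
    · simp

/-! ### Integrable modules and the category `E_τ` -/

section Modules

variable (H r)
variable (W : Type*) [AddCommGroup W] [Module ℂ W] [LieRingModule (Toroidal H r) W]
  [LieModule ℂ (Toroidal H r) W]

/-- The linear span in `τ` of the Cartan subalgebra `H` (placed in degree zero), the `K₀(n)` and
the `Kᵢ`. -/
def extCartan : Submodule ℂ (Toroidal H r) :=
  Submodule.span ℂ ({x | ∃ h ∈ H, x = elt H 0 h} ∪ Set.range (K₀ H) ∪ Set.range (K H))

/-- The weight space `W_λ` for a linear functional `λ` on `extCartan`. -/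
def weightSpace (lam : Module.Dual ℂ (extCartan H r)) : Submodule ℂ W where
  carrier := {w | ∀ x : extCartan H r, ⁅(x : Toroidal H r), w⁆ = lam x • w}
  add_mem' {u v} hu hv x := by rw [lie_add, hu x, hv x, smul_add]
  zero_mem' x := by simp
  smul_mem' c w hw x := by rw [lie_smul, hw x, smul_comm]

open Classical in
/-- Integrable `τ`-modules: `W` is the direct sum of its weight spaces, and for every
root `α`, every root vector `x_α` and every multi-index `n` the element `x_α(n)` acts locally
nilpotently. -/
def IsIntegrable : Prop :=
  DirectSum.IsInternal (weightSpace H r W) ∧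
    ∀ α : H.root, ∀ x ∈ LieAlgebra.rootSpace H (α : LieModule.Weight ℂ H g),
      ∀ (n : Idx r) (w : W), ∃ k : ℕ,
        ((LieModule.toEnd ℂ (Toroidal H r) W (elt H n x)) ^ k) w = 0

variable {W}

/-- The formal series `a(x₀, …, x_r) w = ∑ₙ (a(n) w) x₀^{-n₀-1} ⋯ x_r^{-n_r-1}` with coefficients
in `W`, as the function sending a multi-index `e` to the coefficient of `x^e`. -/
def genSeries (a : g) (w : W) : Idx r → W :=
  fun e => ⁅elt H (fun i => - e i - 1) a, w⁆

/-- The product `p(x_i) f(x₀, …, x_r)` of a polynomial in the variable `x_i` and a doubly infinite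
formal series. -/
def polyMul {r : ℕ} {V : Type*} [AddCommGroup V] [Module ℂ V] (p : Polynomial ℂ)
    (i : Fin (r + 1)) (f : Idx r → V) : Idx r → V :=
  fun e => p.sum fun k c => c • f (e - Pi.single i (k : ℤ))

variable (W)

/-- `W` belongs to `E_τ`: there are nonzero polynomials `p₀, …, p_r` with
`pᵢ(xᵢ) a(x₀, …, x_r) w = 0` for all `i`, `a ∈ g` and `w ∈ W`. -/
def InCategoryE : Prop :=
  ∃ p : Fin (r + 1) → Polynomial ℂ, (∀ i, p i ≠ 0) ∧
    ∀ (i : Fin (r + 1)) (a : g) (w : W), polyMul (p i) i (genSeries H r a w) = 0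

end Modules

/-! ### Evaluation modules -/

/-- The monomial `t^n` evaluated at `z`, as a character of `ℤ^{r+1}`. -/
def monomialEval {r : ℕ} (z : Fin (r + 1) → ℂˣ) : Multiplicative (Idx r) →* ℂ where
  toFun n := ∏ i, ((z i : ℂ) ^ (n.toAdd i))
  map_one' := by simp
  map_mul' n m := by simp [zpow_add₀, Finset.prod_mul_distrib]

/-- Evaluation `f ⊗ a ↦ f(z) a` on the multi-loop algebra. -/
def loopEval {g : Type*} [LieRing g] [LieAlgebra ℂ g] {r : ℕ} (z : Fin (r + 1) → ℂˣ) :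
    LieAlgebra.loopAlgebra ℂ (Idx r) g →ₗ[ℂ] g :=
  (TensorProduct.lid ℂ g).toLinearMap ∘ₗ
    LinearMap.rTensor g (AddMonoidAlgebra.lift ℂ ℂ (Idx r) (monomialEval z)).toLinearMap

lemma loopEval_monomial {g : Type*} [LieRing g] [LieAlgebra ℂ g] {r : ℕ}
    (z : Fin (r + 1) → ℂˣ) (n : Idx r) (a : g) :
    loopEval z (monomial n a) = (∏ i, ((z i : ℂ) ^ n i)) • a := by
  simp [loopEval, monomial, monomialEval]

lemma lie_of_span {L L' : Type*} [LieRing L] [LieAlgebra ℂ L] [LieRing L'] [LieAlgebra ℂ L']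
    (f : L →ₗ[ℂ] L') (S : Set L) (hS : Submodule.span ℂ S = ⊤)
    (h : ∀ x ∈ S, ∀ y ∈ S, f ⁅x, y⁆ = ⁅f x, f y⁆) (x y : L) : f ⁅x, y⁆ = ⁅f x, f y⁆ := by
  have hx : x ∈ Submodule.span ℂ S := hS ▸ Submodule.mem_top
  have hy : y ∈ Submodule.span ℂ S := hS ▸ Submodule.mem_top
  induction hx using Submodule.span_induction with
  | zero => simp
  | add u v _ _ hu hv => rw [add_lie, map_add, map_add, add_lie, hu, hv]
  | smul c u _ hu => rw [smul_lie, map_smul, map_smul, smul_lie, hu]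
  | mem x hx =>
    induction hy using Submodule.span_induction with
    | zero => simp
    | add u v _ _ hu hv => rw [lie_add, map_add, map_add, lie_add, hu, hv]
    | smul c u _ hu => rw [lie_smul, map_smul, map_smul, lie_smul, hu]
    | mem y hy => exact h x hx y hy

lemma loopEval_lie {g : Type*} [LieRing g] [LieAlgebra ℂ g] {r : ℕ} (z : Fin (r + 1) → ℂˣ)
    (x y : LieAlgebra.loopAlgebra ℂ (Idx r) g) :
    loopEval z ⁅x, y⁆ = ⁅loopEval z x, loopEval z y⁆ := by
  refine lie_of_span (loopEval z) {x | ∃ n a, monomial n a = x} span_monomial ?_ x y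
  rintro _ ⟨n, a, rfl⟩ _ ⟨m, b, rfl⟩
  refine (congrArg (loopEval z) (monomial_lie n m a b)).trans ?_
  rw [loopEval_monomial, loopEval_monomial, loopEval_monomial, smul_lie, lie_smul, smul_smul]
  congr 1
  rw [← Finset.prod_mul_distrib]
  exact Finset.prod_congr rfl fun i _ => zpow_add₀ (Units.ne_zero _) _ _

/-- The evaluation homomorphism `τ → g`: `a(n) ↦ z₀^{n₀} ⋯ z_r^{n_r} a`, and the centre goes
to `0`. -/
def evalHom (H : LieSubalgebra ℂ g) [H.IsCartanSubalgebra] {r : ℕ} (z : Fin (r + 1) → ℂˣ) :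
    Toroidal H r →ₗ⁅ℂ⁆ g where
  toFun x := loopEval z ((LieAlgebra.ofProd (cocycle H r)).symm x).1
  map_add' _ _ := map_add (loopEval z) _ _
  map_smul' c _ := map_smul (loopEval z) c _
  map_lie' {_ _} := loopEval_lie z _ _

lemma evalHom_elt (z : Fin (r + 1) → ℂˣ) (n : Idx r) (a : g) :
    evalHom H z (elt H n a) = (∏ i, ((z i : ℂ) ^ n i)) • a :=
  loopEval_monomial z n a

lemma evalHom_centerIncl (z : Fin (r + 1) → ℂˣ) (c : Center r) :
    evalHom H z (centerIncl H c) = 0 :=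
  map_zero (loopEval z)

section Evaluation

variable {s : ℕ} (U : Fin s → Type*) [∀ j, AddCommGroup (U j)] [∀ j, Module ℂ (U j)]

/-- The endomorphism `u₁ ⊗ ⋯ ⊗ u_s ↦ u₁ ⊗ ⋯ ⊗ f u_j ⊗ ⋯ ⊗ u_s`. -/
def slot (j : Fin s) : Module.End ℂ (U j) →ₗ[ℂ] Module.End ℂ (⨂[ℂ] i, U i) where
  toFun f := PiTensorProduct.map (Pi.mulSingle (M := fun i => Module.End ℂ (U i)) j f)
  map_add' f f' := PiTensorProduct.map_update_add _ j f f'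
  map_smul' c f := PiTensorProduct.map_update_smul _ j c f

lemma slot_mul (j : Fin s) (f f' : Module.End ℂ (U j)) :
    slot U j (f * f') = slot U j f * slot U j f' := by
  change PiTensorProduct.mapMonoidHom _ =
    PiTensorProduct.mapMonoidHom _ * PiTensorProduct.mapMonoidHom _
  rw [← map_mul, Pi.mulSingle_mul]

lemma slot_commute {j k : Fin s} (h : j ≠ k) (f : Module.End ℂ (U j)) (f' : Module.End ℂ (U k)) :
    slot U j f * slot U k f' = slot U k f' * slot U j f := by
  change PiTensorProduct.mapMonoidHom _ * PiTensorProduct.mapMonoidHom _ =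
    PiTensorProduct.mapMonoidHom _ * PiTensorProduct.mapMonoidHom _
  rw [← map_mul, ← map_mul]
  exact congrArg _ (Pi.mulSingle_commute (f := fun i => Module.End ℂ (U i)) h f f').eq

lemma slot_tprod (j : Fin s) (f : Module.End ℂ (U j)) (u : ∀ i, U i) :
    slot U j f (PiTensorProduct.tprod ℂ u) =
      PiTensorProduct.tprod ℂ (Function.update u j (f (u j))) := by
  refine (PiTensorProduct.map_tprod _ u).trans (congrArg _ (funext fun i => ?_))
  rcases eq_or_ne i j with rfl | h
  · simp
  · simp [h]

variable [∀ j, LieRingModule g (U j)] [∀ j, LieModule ℂ g (U j)]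

/-- The action of `τ` on `U₁(z₁) ⊗ ⋯ ⊗ U_s(z_s)`:
`a(n) (u₁ ⊗ ⋯ ⊗ u_s) = ∑ⱼ z_{0j}^{n₀} ⋯ z_{rj}^{n_r} (u₁ ⊗ ⋯ ⊗ a uⱼ ⊗ ⋯ ⊗ u_s)`, with
trivial action of the centre. -/
def evalAction (H : LieSubalgebra ℂ g) [H.IsCartanSubalgebra] {r : ℕ}
    (z : Fin s → Fin (r + 1) → ℂˣ) :
    Toroidal H r →ₗ[ℂ] Module.End ℂ (⨂[ℂ] i, U i) where
  toFun x := ∑ j, slot U j (LieModule.toEnd ℂ g (U j) (evalHom H (z j) x))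
  map_add' x y := by simp [Finset.sum_add_distrib]
  map_smul' c x := by simp [Finset.smul_sum]

lemma evalAction_lie (z : Fin s → Fin (r + 1) → ℂˣ) (x y : Toroidal H r) :
    evalAction U H z ⁅x, y⁆ =
      evalAction U H z x * evalAction U H z y - evalAction U H z y * evalAction U H z x := by
  have hE (j : Fin s) (a b : g) : LieModule.toEnd ℂ g (U j) ⁅a, b⁆ =
      LieModule.toEnd ℂ g (U j) a * LieModule.toEnd ℂ g (U j) b -
        LieModule.toEnd ℂ g (U j) b * LieModule.toEnd ℂ g (U j) a := by
    ext u; simp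
  change ∑ j, slot U j (LieModule.toEnd ℂ g (U j) (evalHom H (z j) ⁅x, y⁆)) =
    (∑ j, slot U j (LieModule.toEnd ℂ g (U j) (evalHom H (z j) x))) *
      (∑ j, slot U j (LieModule.toEnd ℂ g (U j) (evalHom H (z j) y))) -
    (∑ j, slot U j (LieModule.toEnd ℂ g (U j) (evalHom H (z j) y))) *
      (∑ j, slot U j (LieModule.toEnd ℂ g (U j) (evalHom H (z j) x)))
  rw [Finset.sum_mul_sum, Finset.sum_mul_sum, Finset.sum_comm (s := Finset.univ)
    (f := fun i j => slot U i (LieModule.toEnd ℂ g (U i) (evalHom H (z i) y)) *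
      slot U j (LieModule.toEnd ℂ g (U j) (evalHom H (z j) x))), ← Finset.sum_sub_distrib]
  refine Finset.sum_congr rfl fun j _ => ?_
  rw [← Finset.sum_sub_distrib, Finset.sum_eq_single j]
  · rw [LieHom.map_lie, hE, map_sub, slot_mul, slot_mul]
  · intro k _ hk
    rw [slot_commute U hk.symm, sub_self]
  · simp

/-- The evaluation module `U₁(z₁) ⊗ ⋯ ⊗ U_s(z_s)`. -/
@[nolint unusedArguments]
def EvalModule {r : ℕ} (_z : Fin s → Fin (r + 1) → ℂˣ) : Type _ := ⨂[ℂ] i, U i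

variable (z : Fin s → Fin (r + 1) → ℂˣ)

instance : AddCommGroup (EvalModule U z) := inferInstanceAs (AddCommGroup (⨂[ℂ] i, U i))

instance : Module ℂ (EvalModule U z) := inferInstanceAs (Module ℂ (⨂[ℂ] i, U i))

instance : LieRingModule (Toroidal H r) (EvalModule U z) where
  bracket x w := evalAction U H z x w
  add_lie x y w := congrArg (fun f : Module.End ℂ (⨂[ℂ] i, U i) => f w)
    (map_add (evalAction U H z) x y)
  lie_add x v w := map_add (evalAction U H z x) v w
  leibniz_lie x y w := by
    have h := congrArg (fun f : Module.End ℂ (⨂[ℂ] i, U i) => f w) (evalAction_lie U z x y)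
    exact sub_eq_iff_eq_add.mp h.symm

instance : LieModule ℂ (Toroidal H r) (EvalModule U z) where
  smul_lie c x w := congrArg (fun f : Module.End ℂ (⨂[ℂ] i, U i) => f w)
    (map_smul (evalAction U H z) c x)
  lie_smul c x w := map_smul (evalAction U H z x) c w

/-- The defining formula of the evaluation module. -/
theorem elt_lie_tprod (n : Idx r) (a : g) (u : ∀ j, U j) :
    (⁅elt H n a, (PiTensorProduct.tprod ℂ u : EvalModule U z)⁆ : EvalModule U z) =
      ∑ j, (∏ i, ((z j i : ℂ) ^ n i)) •
        (PiTensorProduct.tprod ℂ (Function.update u j ⁅a, u j⁆) : EvalModule U z) := by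
  change (∑ j, slot U j (LieModule.toEnd ℂ g (U j) (evalHom H (z j) (elt H n a))))
    (PiTensorProduct.tprod ℂ u) = _
  rw [LinearMap.sum_apply]
  refine Finset.sum_congr rfl fun j _ => ?_
  rw [evalHom_elt, map_smul, map_smul, LinearMap.smul_apply, slot_tprod]
  rfl

end Evaluation

end ToroidalLie

end

/-! Forward direction. In the category, `p 0` of `t₀` times any `t^n ⊗ a` acts by zero. Bracketing
this relation with `b(m)` leaves only central terms, and the delta in the cocycle isolates one
coefficient of `p 0`; hence the centre acts by zero (`InCategoryE.centerIncl_lie`). So `W` is a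
module over `A ⊗ g`, with `A` the Laurent polynomial ring. Because `g` is perfect, the functions `f`
for which `f ⊗ g` acts by zero form an ideal `J`. It contains every `pᵢ(tᵢ)`, so `A ⧸ J` is
finite-dimensional.

Integrability supplies many locally nilpotent operators: the root vectors, and also the conjugates
`exp(-ad f) e = e + h - f`, which reach the Cartan subalgebra. Finitely many of them span the image
of `A ⊗ g`, and sorting words in the style of Poincaré-Birkhoff-Witt makes the irreducible module
`W` finite-dimensional (`finiteDimensional_of_locallyNilpotent`). Nilpotency also makes `J` radical:
if `f² ∈ J`, the operators from `fA ⊗ g` commute, so the nilpotent ones share a kernel vector, and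
irreducibility gives `f ∈ J` (`IsCurrentRep.isRadical`). Thus `A ⧸ J` is a product of copies of `ℂ`,
one for each of finitely many points, and `W` is irreducible under as many commuting copies of `g`.
Such a space is a tensor product of irreducible `g`-modules (`exists_piTensorProduct_equiv`):
minimal left ideals of the algebras generated by the copies serve as factors, and multiplying their
elements and applying the result to a vector is an isomorphism by Schur's argument.

Converse. Independence of characters at distinct points lets the action of `τ` separate the tensor
slots, and Burnside's theorem then gives irreducibility. Root vectors are nilpotent on each factor,
the weight vectors span a nonzero submodule, and the polynomials with roots at the coordinates of
the points annihilate the series. -/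

noncomputable section
namespace ToroidalLie

/-! ### Burnside's theorem and irreducibility of tensor products -/

/-- **Burnside's theorem**: an irreducible set of operators on a finite-dimensional complex vector
space generates the full endomorphism algebra. -/
theorem adjoin_eq_top_of_irreducible {U : Type*} [AddCommGroup U] [Module ℂ U]
    [FiniteDimensional ℂ U] [Nontrivial U] (S : Set (Module.End ℂ U))
    (h : ∀ N : Submodule ℂ U, (∀ f ∈ S, ∀ u ∈ N, f u ∈ N) → N = ⊥ ∨ N = ⊤) :
    Algebra.adjoin ℂ S = ⊤ := by
  set B := Algebra.adjoin ℂ S with hB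
  have hs : IsSimpleModule B U := by
    refine (isSimpleModule_iff B U).mpr ⟨fun N => ?_⟩
    have := h (N.restrictScalars ℂ) fun f hf u hu =>
      N.smul_mem (⟨f, Algebra.subset_adjoin hf⟩ : B) hu
    simpa using this
  -- Schur's lemma: an eigenspace of `φ` is stable under `S` and nonzero, hence everything.
  have hscalar (φ : Module.End B U) : ∃ c : ℂ, ∀ u, φ u = c • u := by
    let φ' : Module.End ℂ U := φ.restrictScalars ℂ
    obtain ⟨c, hc⟩ := Module.End.exists_eigenvalue φ'
    refine ⟨c, fun u => ?_⟩
    have hst := h (φ'.eigenspace c) fun f hf u hu => by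
      rw [Module.End.mem_eigenspace_iff] at hu ⊢
      have e : φ ((⟨f, Algebra.subset_adjoin hf⟩ : B) • u) = _ := map_smul φ _ u
      change φ (f u) = c • f u
      change φ u = c • u at hu
      refine e.trans ?_
      rw [hu]
      exact map_smul f c u
    have htop := hst.resolve_left hc
    exact Module.End.mem_eigenspace_iff.mp (htop ▸ Submodule.mem_top : u ∈ φ'.eigenspace c)
  refine Algebra.eq_top_iff.mpr fun f => ?_
  -- Since `End_B(U)` consists of scalars, any linear `f` is linear over it, and density applies on
  -- a finite spanning set.
  let F : Module.End (Module.End B U) U :=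
    { toFun := f
      map_add' := map_add f
      map_smul' := fun φ u => by
        obtain ⟨c, hc⟩ := hscalar φ
        simp [hc] }
  obtain ⟨s, hs⟩ := Module.Finite.fg_top (R := ℂ) (M := U)
  obtain ⟨b, hb⟩ := jacobson_density F s
  have : f = b.1 := by
    refine LinearMap.ext_on hs fun u hu => hb u hu
  exact this ▸ b.2

section Slot

variable {s : ℕ} (U : Fin s → Type*) [∀ j, AddCommGroup (U j)] [∀ j, Module ℂ (U j)]

lemma slot_one (j : Fin s) : slot U j 1 = 1 := by
  change PiTensorProduct.mapMonoidHom _ = _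
  rw [Pi.mulSingle_one, map_one]

/-- A tensor product of irreducible sets of operators is irreducible. -/
theorem piTensorProduct_irreducible [∀ j, FiniteDimensional ℂ (U j)] [∀ j, Nontrivial (U j)]
    (S : ∀ j, Set (Module.End ℂ (U j)))
    (h : ∀ j, ∀ N : Submodule ℂ (U j), (∀ f ∈ S j, ∀ u ∈ N, f u ∈ N) → N = ⊥ ∨ N = ⊤)
    (N : Submodule ℂ (⨂[ℂ] i, U i)) (hN : ∀ j, ∀ f ∈ S j, ∀ x ∈ N, slot U j f x ∈ N) :
    N = ⊥ ∨ N = ⊤ := by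
  -- By Burnside, stability under `S j` in one slot extends to all endomorphisms of `U j`; products
  -- over the slots then give every `PiTensorProduct.map f`.
  have h1 (j : Fin s) (f : Module.End ℂ (U j)) : ∀ x ∈ N, slot U j f x ∈ N := by
    have hf : f ∈ Algebra.adjoin ℂ (S j) := by
      rw [adjoin_eq_top_of_irreducible (S j) (h j)]; trivial
    induction hf using Algebra.adjoin_induction with
    | mem f hf => exact hN j f hf
    | algebraMap c =>
      intro x hx
      rw [Algebra.algebraMap_eq_smul_one, map_smul, slot_one]
      exact N.smul_mem c hx
    | add f f' _ _ hf hf' =>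
      intro x hx
      rw [map_add]
      exact N.add_mem (hf x hx) (hf' x hx)
    | mul f f' _ _ hf hf' =>
      intro x hx
      rw [slot_mul]
      exact hf _ (hf' x hx)
  have h2 (f : ∀ j, Module.End ℂ (U j)) : ∀ x ∈ N, PiTensorProduct.map f x ∈ N := by
    have h3 (T : Finset (Fin s)) : ∀ x ∈ N,
        PiTensorProduct.mapMonoidHom (fun j => if j ∈ T then f j else 1) x ∈ N := by
      induction T using Finset.induction_on with
      | empty =>
        intro x hx
        have : (fun j => if j ∈ (∅ : Finset (Fin s)) then f j else 1) = 1 := by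
          funext j; simp
        rw [this, map_one]; exact hx
      | insert i T hi ih =>
        intro x hx
        have : (fun j => if j ∈ insert i T then f j else 1) =
            Pi.mulSingle (M := fun j => Module.End ℂ (U j)) i (f i) *
              fun j => if j ∈ T then f j else 1 := by
          funext j
          rcases eq_or_ne j i with rfl | hj
          · simp [hi]
          · simp [hj]
        rw [this, map_mul]
        exact h1 i (f i) _ (ih x hx)
    simpa using h3 Finset.univ
  by_cases hbot : N = ⊥
  · exact Or.inl hbot
  refine Or.inr (eq_top_iff.mpr ?_)
  obtain ⟨x, hx, hx0⟩ := N.exists_mem_ne_zero_of_ne_bot hbot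
  let b := fun j => Module.finBasis ℂ (U j)
  let bb := _root_.Basis.piTensorProduct b
  obtain ⟨p, hp⟩ : ∃ p, bb.repr x p ≠ 0 := by
    by_contra! hc
    exact hx0 (bb.ext_elem fun q => by simp [hc])
  rw [← PiTensorProduct.span_tprod_eq_top, Submodule.span_le]
  rintro _ ⟨u, rfl⟩
  -- A tensor product of rank-one operators sends `x` to its nonzero `p`-th coordinate times an
  -- arbitrary pure tensor.
  have e : PiTensorProduct.map (fun j => ((b j).coord (p j)).smulRight (u j)) =
      (bb.coord p).smulRight (PiTensorProduct.tprod ℂ u) := by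
    refine PiTensorProduct.ext (MultilinearMap.ext fun y => ?_)
    simp only [LinearMap.compMultilinearMap_apply, PiTensorProduct.map_tprod,
      LinearMap.smulRight_apply, Module.Basis.coord_apply, bb,
      _root_.Basis.piTensorProduct_repr_tprod_apply]
    exact MultilinearMap.map_smul_univ _ _ _
  have h4 := h2 (fun j => ((b j).coord (p j)).smulRight (u j)) x hx
  rw [e] at h4
  exact (N.smul_mem_iff hp).mp h4

end Slot

lemma irreducible_toEnd {g U : Type*} [LieRing g] [LieAlgebra ℂ g] [AddCommGroup U] [Module ℂ U]
    [LieRingModule g U] [LieModule ℂ g U] [LieModule.IsIrreducible ℂ g U] (N : Submodule ℂ U)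
    (hN : ∀ f ∈ Set.range (LieModule.toEnd ℂ g U), ∀ u ∈ N, f u ∈ N) : N = ⊥ ∨ N = ⊤ := by
  let N' : LieSubmodule ℂ g U := { N with lie_mem := fun {a} {u} hu => hN _ ⟨a, rfl⟩ u hu }
  have e : (N' : Submodule ℂ U) = N := rfl
  rcases eq_bot_or_eq_top N' with h | h
  · left; rw [← e, h]; simp
  · right; rw [← e, h]; simp

/-! ### Spaces irreducible under commuting copies of a Lie algebra -/

section Decomposition

/-- The factors are chosen from right to left, each one for the nonzero vector produced so far. -/
lemma exists_ofFn_prod_apply_ne_zero {W : Type*} [AddCommGroup W] [Module ℂ W] :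
    ∀ {n : ℕ} (X : Fin n → Set (Module.End ℂ W)),
      (∀ j, ∀ w ≠ 0, ∃ x ∈ X j, x w ≠ 0) → ∀ w ≠ 0,
      ∃ x : Fin n → Module.End ℂ W, (∀ j, x j ∈ X j) ∧ (List.ofFn x).prod w ≠ 0
  | 0, _, _, w, hw => ⟨fun _ => 0, fun j => j.elim0, by simpa using hw⟩
  | n + 1, X, h, w, hw => by
    obtain ⟨x, hx, hxw⟩ :=
      exists_ofFn_prod_apply_ne_zero (fun j => X j.succ) (fun j => h j.succ) w hw
    obtain ⟨y, hy, hyw⟩ := h 0 _ hxw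
    refine ⟨Fin.cons y x, Fin.cases hy hx, ?_⟩
    simpa [List.ofFn_succ] using hyw

/-- A factor inserted at position `j` slides to the front past the factors it commutes with. This is
what makes the multiplication map below equivariant. -/
lemma ofFn_update_prod {R : Type*} [Monoid R] :
    ∀ {n : ℕ} (x : Fin n → R) (j : Fin n) (y : R), (∀ k, k ≠ j → Commute y (x k)) →
      (List.ofFn (Function.update x j (y * x j))).prod = y * (List.ofFn x).prod
  | 0, _, j, _, _ => j.elim0
  | n + 1, x, j, y, h => by
    rw [List.ofFn_succ, List.ofFn_succ, List.prod_cons, List.prod_cons]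
    rcases Fin.eq_zero_or_eq_succ j with rfl | ⟨j, rfl⟩
    · have e : (fun k : Fin n => Function.update x 0 (y * x 0) k.succ) =
          fun k : Fin n => x k.succ := by
        funext k
        rw [Function.update_of_ne (Fin.succ_ne_zero k)]
      rw [e, Function.update_self, mul_assoc]
    · have := ofFn_update_prod (fun k : Fin n => x k.succ) j y
        fun k hk => h k.succ fun e => hk (Fin.succ_injective _ e)
      have e : (fun k : Fin n => Function.update x j.succ (y * x j.succ) k.succ) =
          Function.update (fun k : Fin n => x k.succ) j (y * x j.succ) := by
        funext k
        rcases eq_or_ne k j with rfl | hk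
        · simp
        · simp [hk]
      rw [e, this, Function.update_of_ne (Fin.succ_ne_zero j).symm, ← mul_assoc, ← mul_assoc,
        (h 0 (Fin.succ_ne_zero j).symm).eq]

variable {g : Type*} [LieRing g] [LieAlgebra ℂ g] {W : Type v} [AddCommGroup W] [Module ℂ W]

/-- Left multiplication makes a stable space of endomorphisms a module. -/
@[reducible]
def leftLieRingModule (σ : g →ₗ[ℂ] Module.End ℂ W)
    (hσ : ∀ a b, σ ⁅a, b⁆ = σ a * σ b - σ b * σ a) (P : Submodule ℂ (Module.End ℂ W))
    (hP : ∀ a, ∀ u ∈ P, σ a * u ∈ P) : LieRingModule g P where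
  bracket a u := ⟨σ a * u, hP a u u.2⟩
  add_lie a b u := Subtype.ext (by
    change σ (a + b) * (u : Module.End ℂ W) = σ a * u + σ b * u
    rw [map_add, add_mul])
  lie_add a u v := Subtype.ext (mul_add _ _ _)
  leibniz_lie a b u := Subtype.ext (by
    change σ a * (σ b * (u : Module.End ℂ W)) = σ ⁅a, b⁆ * u + σ b * (σ a * u)
    rw [hσ, sub_mul, mul_assoc, mul_assoc,
      sub_add_cancel])

lemma leftLieModule (σ : g →ₗ[ℂ] Module.End ℂ W)
    (hσ : ∀ a b, σ ⁅a, b⁆ = σ a * σ b - σ b * σ a) (P : Submodule ℂ (Module.End ℂ W))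
    (hP : ∀ a, ∀ u ∈ P, σ a * u ∈ P) :
    letI := leftLieRingModule σ hσ P hP
    LieModule ℂ g P :=
  letI := leftLieRingModule σ hσ P hP
  { smul_lie := fun c a u => Subtype.ext (by
      change σ (c • a) * (u : Module.End ℂ W) = c • (σ a * u)
      rw [map_smul, smul_mul_assoc])
    lie_smul := fun c a u => Subtype.ext (mul_smul_comm _ _ _) }

/-- A minimal left ideal of the algebra generated by `σ` is a simple left module over it, and serves
as a tensor factor. Existence is by finite dimension, the whole algebra being nonzero and stable. -/
lemma exists_minimal_left_ideal [FiniteDimensional ℂ W] [Nontrivial W]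
    (σ : g →ₗ[ℂ] Module.End ℂ W) :
    ∃ P : Submodule ℂ (Module.End ℂ W), P ≤ (Algebra.adjoin ℂ (Set.range σ)).toSubmodule ∧
      P ≠ ⊥ ∧ (∀ a, ∀ u ∈ P, σ a * u ∈ P) ∧
      ∀ Q ≤ P, (∀ a, ∀ u ∈ Q, σ a * u ∈ Q) → Q ≠ ⊥ → Q = P := by
  let C : Set (Submodule ℂ (Module.End ℂ W)) :=
    {P | P ≤ (Algebra.adjoin ℂ (Set.range σ)).toSubmodule ∧ P ≠ ⊥ ∧ ∀ a, ∀ u ∈ P, σ a * u ∈ P}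
  have hC : C.Nonempty := by
    refine ⟨(Algebra.adjoin ℂ (Set.range σ)).toSubmodule, le_rfl, ?_, ?_⟩
    · intro h
      have : (1 : Module.End ℂ W) ∈ (Algebra.adjoin ℂ (Set.range σ)).toSubmodule :=
        (Algebra.adjoin ℂ (Set.range σ)).one_mem
      rw [h, Submodule.mem_bot] at this
      exact one_ne_zero this
    · exact fun a u hu => (Algebra.adjoin ℂ (Set.range σ)).mul_mem (Algebra.subset_adjoin ⟨a, rfl⟩) hu
  obtain ⟨P, ⟨h1, h2, h3⟩, h4⟩ := wellFounded_lt.has_min C hC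
  refine ⟨P, h1, h2, h3, fun Q hQ hs h0 => ?_⟩
  by_contra hne
  exact h4 Q ⟨hQ.trans h1, h0, hs⟩ (lt_of_le_of_ne hQ hne)

/-- Schur's argument: the kernel is stable in the irreducible tensor product, the range in the
irreducible space `W`. -/
lemma bijective_of_equivariant {s : ℕ} (U : Fin s → Type*) [∀ j, AddCommGroup (U j)]
    [∀ j, Module ℂ (U j)] [∀ j, LieRingModule g (U j)] [∀ j, LieModule ℂ g (U j)]
    [∀ j, FiniteDimensional ℂ (U j)] [∀ j, Nontrivial (U j)]
    [∀ j, LieModule.IsIrreducible ℂ g (U j)] (σ : Fin s → g →ₗ[ℂ] Module.End ℂ W)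
    (hirr : ∀ N : Submodule ℂ W, (∀ j a, ∀ w ∈ N, σ j a w ∈ N) → N = ⊥ ∨ N = ⊤)
    (Φ : (⨂[ℂ] i, U i) →ₗ[ℂ] W) (hΦ0 : Φ ≠ 0)
    (hΦ : ∀ j a x, Φ (slot U j (LieModule.toEnd ℂ g (U j) a) x) = σ j a (Φ x)) :
    Function.Bijective Φ := by
  constructor
  · rw [← LinearMap.ker_eq_bot]
    refine (piTensorProduct_irreducible U (fun j => Set.range (LieModule.toEnd ℂ g (U j)))
      (fun j N hN => irreducible_toEnd N hN) _ ?_).resolve_right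
        fun h => hΦ0 (LinearMap.ker_eq_top.mp h)
    rintro j _ ⟨a, rfl⟩ y hy
    rw [LinearMap.mem_ker] at hy ⊢
    rw [hΦ, hy, map_zero]
  · rw [← LinearMap.range_eq_top]
    refine (hirr _ ?_).resolve_left fun h => hΦ0 (LinearMap.range_eq_bot.mp h)
    rintro j a _ ⟨y, rfl⟩
    exact ⟨_, hΦ j a y⟩

/-- A finite-dimensional space which is irreducible under commuting actions of copies of `g` is a
tensor product of irreducible `g`-modules. -/
theorem exists_piTensorProduct_equiv [FiniteDimensional ℂ W] [Nontrivial W] {s : ℕ}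
    (σ : Fin s → g →ₗ[ℂ] Module.End ℂ W)
    (hσ : ∀ j a b, σ j ⁅a, b⁆ = σ j a * σ j b - σ j b * σ j a)
    (hcomm : ∀ j k, j ≠ k → ∀ a b, Commute (σ j a) (σ k b))
    (hirr : ∀ N : Submodule ℂ W, (∀ j a, ∀ w ∈ N, σ j a w ∈ N) → N = ⊥ ∨ N = ⊤) :
    ∃ (U : Fin s → Type v) (_ : ∀ j, AddCommGroup (U j)) (_ : ∀ j, Module ℂ (U j))
      (_ : ∀ j, LieRingModule g (U j)) (_ : ∀ j, LieModule ℂ g (U j)),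
      (∀ j, FiniteDimensional ℂ (U j)) ∧ (∀ j, LieModule.IsIrreducible ℂ g (U j)) ∧
      ∃ Φ : (⨂[ℂ] i, U i) ≃ₗ[ℂ] W, ∀ j a x,
        Φ (slot U j (LieModule.toEnd ℂ g (U j) a) x) = σ j a (Φ x) := by
  choose P hPB hP0 hPs hPm using fun j => exists_minimal_left_ideal (σ j)
  let i1 : ∀ j, LieRingModule g (P j) := fun j => leftLieRingModule (σ j) (hσ j) (P j) (hPs j)
  have i2 : ∀ j, LieModule ℂ g (P j) := fun j => leftLieModule (σ j) (hσ j) (P j) (hPs j)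
  have hnt (j) : Nontrivial (P j) := Submodule.nontrivial_iff_ne_bot.mpr (hP0 j)
  have hPirr (j) : LieModule.IsIrreducible ℂ g (P j) := by
    refine LieModule.IsIrreducible.mk fun N hN => ?_
    have h := hPm j ((N : Submodule ℂ (P j)).map (P j).subtype) (Submodule.map_subtype_le _ _)
      (by
        rintro a _ ⟨u, hu, rfl⟩
        exact ⟨⁅a, u⁆, N.lie_mem hu, rfl⟩)
      (by
        intro h
        rw [← Submodule.map_bot (P j).subtype] at h
        exact hN ((LieSubmodule.toSubmodule_eq_bot N).mp
          (Submodule.map_injective_of_injective (P j).injective_subtype h)))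
    rw [← LieSubmodule.toSubmodule_eq_top]
    refine Submodule.map_injective_of_injective (P j).injective_subtype ?_
    rw [h, Submodule.map_top, Submodule.range_subtype]
  have hBcomm (j k) (hjk : k ≠ j) (a : g) (b : Module.End ℂ W)
      (hb : b ∈ Algebra.adjoin ℂ (Set.range (σ j))) : Commute (σ k a) b := by
    induction hb using Algebra.adjoin_induction with
    | mem b hb => obtain ⟨c, rfl⟩ := hb; exact hcomm k j hjk a c
    | algebraMap c => exact (Algebra.commute_algebraMap_left c _).symm
    | add b b' _ _ h h' => exact h.add_right h'
    | mul b b' _ _ h h' => exact h.mul_right h'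
  -- The vectors killed by `P j` times the algebra of `σ j` form a subspace stable under all copies
  -- of `g`. If it contained `w ≠ 0` it would be `W`, and taking `b = 1` would give `P j = 0`.
  have hne (j) (w : W) (hw : w ≠ 0) :
      ∃ x ∈ {x : Module.End ℂ W | ∃ u ∈ P j, ∃ b ∈ Algebra.adjoin ℂ (Set.range (σ j)),
        x = u * b}, x w ≠ 0 := by
    by_contra! hc
    let V : Submodule ℂ W :=
      { carrier := {w | ∀ u ∈ P j, ∀ b ∈ Algebra.adjoin ℂ (Set.range (σ j)), u (b w) = 0}
        add_mem' := fun {v v'} hv hv' u hu b hb => by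
          rw [map_add, map_add, hv u hu b hb, hv' u hu b hb, add_zero]
        zero_mem' := fun u _ b _ => by simp
        smul_mem' := fun c v hv u hu b hb => by
          rw [map_smul, map_smul, hv u hu b hb, smul_zero] }
    have hV := hirr V fun k a v hv u hu b hb => by
      rcases eq_or_ne k j with rfl | hk
      · exact hv u hu (b * σ k a) (mul_mem hb (Algebra.subset_adjoin ⟨a, rfl⟩))
      · have h1 : b (σ k a v) = σ k a (b v) :=
          congrArg (fun f : Module.End ℂ W => f v) (hBcomm j k hk a b hb).eq.symm
        have h2 : u (σ k a (b v)) = σ k a (u (b v)) :=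
          congrArg (fun f : Module.End ℂ W => f (b v)) (hBcomm j k hk a u (hPB j hu)).eq.symm
        rw [h1, h2, hv u hu b hb, map_zero]
    have hwV : w ∈ V := fun u hu b hb => hc (u * b) ⟨u, hu, b, hb, rfl⟩
    have htop : V = ⊤ := hV.resolve_left fun h => hw (by rwa [h, Submodule.mem_bot] at hwV)
    refine hP0 j ((Submodule.eq_bot_iff _).mpr fun u hu => LinearMap.ext fun v => ?_)
    have : v ∈ V := htop ▸ Submodule.mem_top
    exact this u hu 1 (one_mem _)
  obtain ⟨w, hw⟩ := exists_ne (0 : W)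
  obtain ⟨x, hx, hxw⟩ := exists_ofFn_prod_apply_ne_zero _ hne w hw
  choose u hu b hb hxub using hx
  -- The map `y ↦ (y₀ b₀)(y₁ b₁) ⋯ w`. The fixed right factors `b j` keep it nonzero and do not
  -- interfere with left multiplication by `σ j a`.
  let M : MultilinearMap ℂ (fun j => P j) W :=
    (LinearMap.applyₗ w).compMultilinearMap
      ((MultilinearMap.mkPiAlgebraFin ℂ s (Module.End ℂ W)).compLinearMap
        fun j => LinearMap.mulRight ℂ (b j) ∘ₗ (P j).subtype)
  have hM (y : ∀ j, P j) :
      M y = (List.ofFn fun j => (y j : Module.End ℂ W) * b j).prod w := by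
    simp [M, MultilinearMap.mkPiAlgebraFin_apply]
  let Φ : (⨂[ℂ] i, P i) →ₗ[ℂ] W := PiTensorProduct.lift M
  have hΦ (j) (a : g) (y) : Φ (slot (fun j => P j) j (LieModule.toEnd ℂ g (P j) a) y) =
      σ j a (Φ y) := by
    have : Φ ∘ₗ slot (fun j => P j) j (LieModule.toEnd ℂ g (P j) a) = (σ j a) ∘ₗ Φ := by
      refine PiTensorProduct.ext (MultilinearMap.ext fun y => ?_)
      simp only [LinearMap.compMultilinearMap_apply, LinearMap.comp_apply, slot_tprod, Φ,
        PiTensorProduct.lift.tprod, hM]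
      have e : (fun k => ((Function.update y j (LieModule.toEnd ℂ g (P j) a (y j)) k : P k) :
          Module.End ℂ W) * b k) =
          Function.update (fun k => (y k : Module.End ℂ W) * b k) j
            (σ j a * ((y j : Module.End ℂ W) * b j)) := by
        funext k
        rcases eq_or_ne k j with rfl | hk
        · rw [Function.update_self, Function.update_self]
          exact mul_assoc _ _ _
        · rw [Function.update_of_ne hk, Function.update_of_ne hk]
      have e2 := ofFn_update_prod (fun k => (y k : Module.End ℂ W) * b k) j (σ j a)
        fun k hk => (hBcomm k j hk.symm a _ (hPB k (y k).2)).mul_right (hBcomm k j hk.symm a _ (hb k))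
      rw [e, e2]
      rfl
    exact LinearMap.congr_fun this y
  have hΦ0 : Φ ≠ 0 := by
    intro h
    apply hxw
    have h1 := LinearMap.congr_fun h (PiTensorProduct.tprod ℂ fun j => (⟨u j, hu j⟩ : P j))
    simp only [Φ, PiTensorProduct.lift.tprod, hM, LinearMap.zero_apply] at h1
    rwa [show x = fun j => u j * b j from funext hxub]
  exact ⟨fun j => P j, inferInstance, inferInstance, i1, i2, inferInstance, hPirr,
    LinearEquiv.ofBijective Φ (bijective_of_equivariant (fun j => P j) σ hirr Φ hΦ0 hΦ), hΦ⟩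

end Decomposition

/-! ### Finite-dimensionality from local nilpotency -/

section LocallyNilpotent

variable {W : Type*} [AddCommGroup W] [Module ℂ W]

/-- A linear operator is locally nilpotent if every vector is killed by some power of it. -/
def LocallyNilpotent (x : Module.End ℂ W) : Prop := ∀ w, ∃ k : ℕ, (x ^ k) w = 0

lemma pow_apply_eq_zero_of_le {x : Module.End ℂ W} {k l : ℕ} (h : k ≤ l) {w : W}
    (hw : (x ^ k) w = 0) : (x ^ l) w = 0 :=
  Module.End.pow_map_zero_of_le h hw

section Words

variable {ι : Type*} (x : ι → Module.End ℂ W) (w : W)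

/-- The span of the vectors obtained from `w` by applying at most `d` of the operators. -/
def wordSpan (d : ℕ) : Submodule ℂ W :=
  Submodule.span ℂ {v | ∃ l : List ι, l.length ≤ d ∧ (l.map x).prod w = v}

lemma wordSpan_mono {d e : ℕ} (h : d ≤ e) : wordSpan x w d ≤ wordSpan x w e :=
  Submodule.span_mono fun _ ⟨l, hl, hv⟩ => ⟨l, hl.trans h, hv⟩

lemma word_mem_wordSpan {d : ℕ} {l : List ι} (h : l.length ≤ d) :
    (l.map x).prod w ∈ wordSpan x w d :=
  Submodule.subset_span ⟨l, h, rfl⟩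

lemma apply_mem_wordSpan (i : ι) {d : ℕ} {v : W} (hv : v ∈ wordSpan x w d) :
    x i v ∈ wordSpan x w (d + 1) := by
  induction hv using Submodule.span_induction with
  | mem v hv =>
    obtain ⟨l, hl, rfl⟩ := hv
    exact word_mem_wordSpan x w (l := i :: l) (by simpa using hl)
  | zero => simp
  | add u v _ _ hu hv => rw [map_add]; exact add_mem hu hv
  | smul c u _ hu => rw [map_smul]; exact Submodule.smul_mem _ c hu

lemma apply_mem_wordSpan_of_mem_span {y : Module.End ℂ W}
    (hy : y ∈ Submodule.span ℂ (Set.range x)) {d : ℕ} {v : W} (hv : v ∈ wordSpan x w d) :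
    y v ∈ wordSpan x w (d + 1) := by
  induction hy using Submodule.span_induction with
  | mem y hy => obtain ⟨i, rfl⟩ := hy; exact apply_mem_wordSpan x w i hv
  | zero => simp
  | add u v _ _ hu hv => exact add_mem hu hv
  | smul c u _ hu => exact Submodule.smul_mem _ c hu

/-- Reordering a word changes it by shorter words. -/
lemma word_sub_word_mem (hbr : ∀ i j, x i * x j - x j * x i ∈ Submodule.span ℂ (Set.range x))
    {l l' : List ι} (h : l.Perm l') :
    ∀ d, l.length ≤ d + 1 → (l.map x).prod w - (l'.map x).prod w ∈ wordSpan x w d := by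
  induction h with
  | nil => simp
  | @cons a l l' h ih =>
    intro d hd
    rw [List.map_cons, List.map_cons, List.prod_cons, List.prod_cons, Module.End.mul_apply,
      Module.End.mul_apply, ← map_sub]
    rcases d with _ | d
    · have hl : l = [] := by simpa using hd
      subst hl
      rw [List.nil_perm.mp h]
      simp
    · exact apply_mem_wordSpan x w a (ih d (by simpa using hd))
  -- The commutator of two letters is a combination of single letters, so the error is one letter
  -- shorter.
  | swap a b l =>
    intro d hd
    have e : ((b :: a :: l).map x).prod w - ((a :: b :: l).map x).prod w =
        (x b * x a - x a * x b) ((l.map x).prod w) := by simp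
    rw [e]
    refine wordSpan_mono x w ?_ (apply_mem_wordSpan_of_mem_span x w (hbr b a)
      (word_mem_wordSpan x w (le_refl l.length)))
    simpa using hd
  | @trans l₁ l₂ l₃ h₁ h₂ ih₁ ih₂ =>
    intro d hd
    rw [← sub_add_sub_cancel _ ((l₂.map x).prod w)]
    exact add_mem (ih₁ d hd) (ih₂ d (h₁.length_eq ▸ hd))

/-- One power of `y` kills a finite generating set of `V`, so only finitely many of the images are
nonzero. -/
lemma finiteDimensional_iSup_map_pow {y : Module.End ℂ W} (hy : LocallyNilpotent y)
    (V : Submodule ℂ W) [FiniteDimensional ℂ V] :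
    FiniteDimensional ℂ (⨆ k : ℕ, V.map (y ^ k) : Submodule ℂ W) := by
  obtain ⟨s, hs⟩ := (Submodule.fg_iff_finiteDimensional V).mpr inferInstance
  choose n hn using hy
  have hN : V ≤ LinearMap.ker (y ^ s.sup n) := by
    rw [← hs, Submodule.span_le]
    exact fun v hv => pow_apply_eq_zero_of_le (Finset.le_sup hv) (hn v)
  have : (⨆ k : ℕ, V.map (y ^ k)) ≤ ⨆ k : Fin (s.sup n), V.map (y ^ (k : ℕ)) := by
    refine iSup_le fun k => ?_
    rcases lt_or_ge k (s.sup n) with hk | hk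
    · exact le_iSup (fun k : Fin (s.sup n) => V.map (y ^ (k : ℕ))) ⟨k, hk⟩
    · rintro _ ⟨v, hv, rfl⟩
      rw [pow_apply_eq_zero_of_le hk (hN hv)]
      exact zero_mem _
  exact Submodule.finiteDimensional_of_le this

/-- The span of the vectors obtained by applying powers of the listed operators, in order. -/
def orderedSpan : List ι → Submodule ℂ W
  | [] => Submodule.span ℂ {w}
  | i :: L => ⨆ k : ℕ, (orderedSpan L).map (x i ^ k)

lemma finiteDimensional_orderedSpan (hx : ∀ i, LocallyNilpotent (x i)) :
    ∀ L : List ι, FiniteDimensional ℂ (orderedSpan x w L)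
  | [] => by
    rw [orderedSpan]; infer_instance
  | i :: L => by
    have := finiteDimensional_orderedSpan hx L
    exact finiteDimensional_iSup_map_pow (hx i) (orderedSpan x w L)

lemma ordered_word_mem (c : ι → ℕ) (L : List ι) :
    (((L.map fun i => List.replicate (c i) i).flatten).map x).prod w ∈ orderedSpan x w L := by
  induction L with
  | nil => simp [orderedSpan]
  | cons i L ih =>
    refine Submodule.mem_iSup_of_mem (c i) ⟨_, ih, ?_⟩
    simp

/-- The sorted form of a word: equal letters are grouped, in the fixed order of `univ.toList`. Such
words lie in the finite-dimensional `orderedSpan`. -/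
lemma perm_flatten_replicate [Fintype ι] [DecidableEq ι] (l : List ι) :
    l.Perm (((Finset.univ : Finset ι).toList.map fun i => List.replicate (l.count i) i).flatten) := by
  rw [List.perm_iff_count]
  intro a
  rw [List.count_flatten, List.map_map, Finset.sum_map_toList]
  simp [List.count_replicate]

/-- If the operators `x i` are finitely many, locally nilpotent, span a Lie algebra, and are
jointly irreducible, then the space is finite-dimensional. -/
theorem finiteDimensional_of_locallyNilpotent [Finite ι] (hx : ∀ i, LocallyNilpotent (x i))
    (hbr : ∀ i j, x i * x j - x j * x i ∈ Submodule.span ℂ (Set.range x))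
    (hirr : ∀ N : Submodule ℂ W, (∀ i, ∀ w ∈ N, x i w ∈ N) → N = ⊥ ∨ N = ⊤) :
    FiniteDimensional ℂ W := by
  classical
  have := Fintype.ofFinite ι
  rcases subsingleton_or_nontrivial W with hW | hW
  · infer_instance
  obtain ⟨w, hw⟩ := exists_ne (0 : W)
  set F := orderedSpan x w (Finset.univ : Finset ι).toList with hF
  have : FiniteDimensional ℂ F := finiteDimensional_orderedSpan x w hx _
  have hword (l : List ι) (hl : ∀ d, l.length ≤ d + 1 → wordSpan x w d ≤ F) :
      (l.map x).prod w ∈ F := by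
    rcases l with _ | ⟨a, l⟩
    · have := ordered_word_mem x w (fun _ => 0) (Finset.univ : Finset ι).toList
      simpa using this
    · set l' := (((Finset.univ : Finset ι).toList.map fun i =>
        List.replicate ((a :: l).count i) i).flatten)
      rw [← sub_add_cancel (((a :: l).map x).prod w) ((l'.map x).prod w)]
      exact add_mem (hl l.length (by simp) (word_sub_word_mem x w hbr (perm_flatten_replicate _) _
        (by simp))) (ordered_word_mem x w _ _)
  -- Induction on length: a word equals its sorted form, which lies in `F`, modulo shorter words.
  have hT (d : ℕ) : wordSpan x w d ≤ F := by
    induction d with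
    | zero =>
      refine Submodule.span_le.mpr ?_
      rintro _ ⟨l, hl, rfl⟩
      have : l = [] := by simpa using hl
      subst this
      have := ordered_word_mem x w (fun _ => 0) (Finset.univ : Finset ι).toList
      simpa using this
    | succ d ih =>
      refine Submodule.span_le.mpr ?_
      rintro _ ⟨l, hl, rfl⟩
      set l' := (((Finset.univ : Finset ι).toList.map fun i =>
        List.replicate (l.count i) i).flatten)
      rw [← sub_add_cancel ((l.map x).prod w) ((l'.map x).prod w)]
      exact add_mem (ih (word_sub_word_mem x w hbr (perm_flatten_replicate _) _ hl))
        (ordered_word_mem x w _ _)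
  -- The span of all words is stable and contains `w ≠ 0`, so it is `W`.
  have htop := (hirr (⨆ d, wordSpan x w d) fun i v hv => by
    have hdir : Directed (· ≤ ·) (wordSpan x w) :=
      (show Monotone (wordSpan x w) from fun _ _ h => wordSpan_mono x w h).directed_le
    rw [Submodule.mem_iSup_of_directed _ hdir] at hv
    obtain ⟨d, hd⟩ := hv
    exact Submodule.mem_iSup_of_mem (d + 1) (apply_mem_wordSpan x w i hd)).resolve_left
      fun h => hw (by
        have : w ∈ ⨆ d, wordSpan x w d :=
          Submodule.mem_iSup_of_mem 0 (word_mem_wordSpan x w (l := []) le_rfl)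
        rwa [h, Submodule.mem_bot] at this)
  have hFt : F = ⊤ := top_le_iff.mp (htop ▸ iSup_le hT)
  rw [hFt] at this
  exact Module.finite_def.mpr ((Submodule.fg_iff_finiteDimensional _).mpr this)

end Words

/-! ### Conjugation by the exponential of a locally nilpotent operator -/

section Conjugation

variable {F X X₁ X₂ : Module.End ℂ W}

/-- This is `F^m X = ∑ᵢ (m choose i) (ad F)ⁱ(X) F^(m-i)` for `m = k + 2`, where `X₁ = (ad F) X`, `X₂
= (ad F)² X / 2` and the sum stops after three terms. Hence the coefficients `m` and `m (m - 1)`. -/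
lemma pow_mul_eq (h₁ : F * X = X * F + X₁) (h₂ : F * X₁ = X₁ * F + (2 : ℂ) • X₂)
    (h₃ : F * X₂ = X₂ * F) (k : ℕ) :
    F ^ (k + 2) * X = X * F ^ (k + 2) + ((k : ℂ) + 2) • (X₁ * F ^ (k + 1)) +
      (((k : ℂ) + 2) * (k + 1)) • (X₂ * F ^ k) := by
  induction k with
  | zero =>
    rw [pow_succ, pow_one, mul_assoc, h₁, mul_add, ← mul_assoc, h₁, h₂]
    simp only [add_mul, Nat.cast_zero, zero_add, pow_zero, mul_one, mul_assoc]
    module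
  | succ k ih =>
    rw [show k + 1 + 2 = (k + 2) + 1 by ring, pow_succ', mul_assoc, ih, mul_add, mul_add,
      mul_smul_comm, mul_smul_comm, ← mul_assoc F X, ← mul_assoc F X₁, ← mul_assoc F X₂, h₁, h₂, h₃]
    simp only [add_mul, smul_mul_assoc, mul_assoc, ← pow_succ']
    push_cast
    module

/-- The operator `exp (ad F) X` is locally nilpotent if `F` and `X` are, when `(ad F)³ X = 0`. -/
theorem LocallyNilpotent.conj (h₁ : F * X = X * F + X₁) (h₂ : F * X₁ = X₁ * F + (2 : ℂ) • X₂)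
    (h₃ : F * X₂ = X₂ * F) (hF : LocallyNilpotent F) (hX : LocallyNilpotent X) :
    LocallyNilpotent (X + X₁ + X₂) := by
  -- Truncations of `exp F`. They stabilize on each vector, and `e w` below is the stable value
  -- `exp(F) w`.
  let E : ℕ → Module.End ℂ W := fun N => ∑ k ∈ Finset.range N, ((k.factorial : ℂ)⁻¹) • F ^ k
  have hE (w : W) : ∃ v n, ∀ N ≥ n, E N w = v := by
    obtain ⟨n, hn⟩ := hF w
    refine ⟨E n w, n, fun N hN => ?_⟩
    simp only [E, LinearMap.sum_apply, LinearMap.smul_apply]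
    refine (Finset.sum_subset (Finset.range_mono hN) fun k _ hk => ?_).symm
    rw [pow_apply_eq_zero_of_le (by simpa using hk) hn, smul_zero]
  choose e n he using hE
  -- Truncated form of `exp(F) X = (X + X₁ + X₂) exp(F)`; each application of `ad F` lowers the
  -- truncation by one.
  have hEX (N : ℕ) : E (N + 2) * X = X * E (N + 2) + X₁ * E (N + 1) + X₂ * E N := by
    have hk (k : ℕ) : (((k + 2).factorial : ℂ)⁻¹) • F ^ (k + 2) * X =
        X * ((((k + 2).factorial : ℂ)⁻¹) • F ^ (k + 2)) +
        X₁ * ((((k + 1).factorial : ℂ)⁻¹) • F ^ (k + 1)) + X₂ * (((k.factorial : ℂ)⁻¹) • F ^ k) := by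
      rw [smul_mul_assoc, pow_mul_eq h₁ h₂ h₃, mul_smul_comm, mul_smul_comm, mul_smul_comm,
        smul_add, smul_add, smul_smul, smul_smul]
      have hk0 : (k.factorial : ℂ) ≠ 0 := by exact_mod_cast k.factorial_ne_zero
      have hk1 : (k : ℂ) + 1 ≠ 0 := by exact_mod_cast k.succ_ne_zero
      have hk2 : (k : ℂ) + 2 ≠ 0 := by exact_mod_cast (k + 1).succ_ne_zero
      congr 2
      · congr 1
        rw [Nat.factorial_succ (k + 1), Nat.cast_mul, mul_inv, mul_right_comm]
        push_cast
        rw [show (k : ℂ) + 1 + 1 = k + 2 by ring, inv_mul_cancel₀ hk2, one_mul]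
      · rw [Nat.factorial_succ (k + 1), Nat.factorial_succ k]
        push_cast
        rw [show (k : ℂ) + 1 + 1 = k + 2 by ring]
        field_simp
    have e2 : E (N + 2) = (∑ k ∈ Finset.range N, (((k + 2).factorial : ℂ)⁻¹) • F ^ (k + 2)) +
        F + 1 := by
      simp [E, Finset.sum_range_succ']
    have e1 : E (N + 1) = (∑ k ∈ Finset.range N, (((k + 1).factorial : ℂ)⁻¹) • F ^ (k + 1)) +
        1 := by
      simp [E, Finset.sum_range_succ']
    rw [e2, e1, add_mul, add_mul, Finset.sum_mul, Finset.sum_congr rfl fun k _ => hk k,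
      Finset.sum_add_distrib, Finset.sum_add_distrib, ← Finset.mul_sum, ← Finset.mul_sum,
      ← Finset.mul_sum, h₁]
    simp only [E, mul_add, mul_one, one_mul]
    abel
  have hY (w : W) : (X + X₁ + X₂) (e w) = e (X w) := by
    have h := congrArg (fun f : Module.End ℂ W => f w) (hEX (max (n w) (n (X w))))
    simp only [Module.End.mul_apply, LinearMap.add_apply] at h
    rw [he _ _ (by omega), he _ _ (by omega), he _ _ (by omega), he _ _ (by omega)] at h
    rw [h]; rfl
  have e0 : e 0 = 0 := by rw [← he 0 _ le_rfl, map_zero]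
  have hYk (k : ℕ) (w : W) : ((X + X₁ + X₂) ^ k) (e w) = e ((X ^ k) w) := by
    induction k generalizing w with
    | zero => rfl
    | succ k ih => rw [pow_succ, pow_succ, Module.End.mul_apply, hY, ih]; rfl
  -- Surjectivity of `exp F`: if `F^(m+1) v = 0` then `F^m` kills `e v - v`, which is `e w` by
  -- induction, and then `e (v - w) = v`.
  have hsurj (m : ℕ) : ∀ v, (F ^ m) v = 0 → ∃ w, e w = v := by
    induction m with
    | zero => exact fun v hv => ⟨0, by rw [e0]; exact hv.symm⟩
    | succ m ih =>
      intro v hv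
      obtain ⟨w, hw⟩ := ih (e v - v) (by
        rw [← he v (n v + 1) (by omega)]
        have : E (n v + 1) = (∑ k ∈ Finset.range (n v),
            (((k + 1).factorial : ℂ)⁻¹) • F ^ (k + 1)) + 1 := by
          simp [E, Finset.sum_range_succ']
        rw [this, LinearMap.add_apply, Module.End.one_apply, add_sub_cancel_right,
          LinearMap.sum_apply, map_sum]
        refine Finset.sum_eq_zero fun k _ => ?_
        rw [LinearMap.smul_apply, map_smul, ← Module.End.mul_apply, ← pow_add,
          pow_apply_eq_zero_of_le (by omega) hv, smul_zero])
      refine ⟨v - w, ?_⟩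
      have h := map_sub (E (max (n (v - w)) (max (n v) (n w)))) v w
      rw [he _ _ (by omega), he _ _ (by omega), he _ _ (by omega), hw, sub_sub_cancel] at h
      exact h
  intro v
  obtain ⟨m, hm⟩ := hF v
  obtain ⟨w, rfl⟩ := hsurj m v hm
  obtain ⟨k, hk⟩ := hX w
  exact ⟨k, by rw [hYk, hk, e0]⟩

end Conjugation

end LocallyNilpotent

/-! ### Spanning sets and the normalized form of a simple Lie algebra -/

section SimpleLieAlgebra

variable {g : Type*} [LieRing g] [LieAlgebra ℂ g] [LieAlgebra.IsSimple ℂ g]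

variable (g) in
/-- A simple Lie algebra is spanned by brackets. -/
lemma span_lie_eq_top : Submodule.span ℂ {x : g | ∃ a b : g, ⁅a, b⁆ = x} = ⊤ := by
  have h1 : ⁅(⊤ : LieIdeal ℂ g), (⊤ : LieIdeal ℂ g)⁆ = ⊤ := by
    refine (LieAlgebra.IsSimple.eq_bot_or_eq_top _).resolve_left fun h => ?_
    refine LieAlgebra.IsSimple.non_abelian ℂ (L := g) ⟨fun a b => ?_⟩
    have : ⁅a, b⁆ ∈ ⁅(⊤ : LieIdeal ℂ g), (⊤ : LieIdeal ℂ g)⁆ :=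
      LieSubmodule.lie_mem_lie (LieSubmodule.mem_top a) (LieSubmodule.mem_top b)
    rwa [h, LieSubmodule.mem_bot] at this
  have h2 := LieSubmodule.lieIdeal_oper_eq_linear_span' (⊤ : LieSubmodule ℂ g g) (⊤ : LieIdeal ℂ g)
  rw [h1] at h2
  simpa using h2.symm

variable [FiniteDimensional ℂ g] (H : LieSubalgebra ℂ g) [H.IsCartanSubalgebra]

/-- The element `e + h - f` is `exp(-ad f) e`, so it inherits nilpotency from `e` and `f`. It yields
the coroot `h`, and coroots span `H`. `P` is only a set because a sum of locally nilpotent operators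
need not be locally nilpotent. -/
lemma span_eq_top_of_rootSpace_subset (P : Set g)
    (hroot : ∀ α : H.root, ∀ x ∈ LieAlgebra.rootSpace H (α : LieModule.Weight ℂ H g), x ∈ P)
    (hsl2 : ∀ h e f : g, IsSl2Triple h e f → e ∈ P → f ∈ P → e + h - f ∈ P) :
    Submodule.span ℂ P = ⊤ := by
  have hroot' (α : LieModule.Weight ℂ H g) (hα : α.IsNonZero) (x : g)
      (hx : x ∈ LieAlgebra.rootSpace H α) : x ∈ P :=
    hroot ⟨α, by simpa using hα⟩ x hx
  have hcoroot (α : LieModule.Weight ℂ H g) (hα : α.IsNonZero) :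
      (LieAlgebra.IsKilling.coroot α : g) ∈ Submodule.span ℂ P := by
    obtain ⟨h, e, f, ht, he, hf⟩ := LieAlgebra.IsKilling.exists_isSl2Triple_of_weight_isNonZero hα
    rw [← ht.h_eq_coroot hα he hf]
    have he' := hroot' α hα e he
    have hf' := hroot' (-α) hα.neg f hf
    have : h = (e + h - f) - e + f := by abel
    rw [this]
    exact add_mem (sub_mem (Submodule.subset_span (hsl2 h e f ht he' hf'))
      (Submodule.subset_span he')) (Submodule.subset_span hf')
  have hH : ∀ x : H, (x : g) ∈ Submodule.span ℂ P := by
    intro x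
    have hx : x ∈ Submodule.span ℂ (Set.range (LieAlgebra.IsKilling.rootSystem H).coroot) := by
      rw [RootPairing.IsRootSystem.span_coroot_eq_top]; trivial
    induction hx using Submodule.span_induction with
    | mem x hx =>
      obtain ⟨α, rfl⟩ := hx
      exact hcoroot α.1 (LieSubalgebra.isNonZero_coe_root α)
    | zero => simp
    | add u v _ _ hu hv => exact add_mem hu hv
    | smul c u _ hu => exact Submodule.smul_mem _ c hu
  refine Submodule.eq_top_iff'.mpr fun x => ?_
  have hx : x ∈ ⨆ χ : LieModule.Weight ℂ H g, LieModule.genWeightSpace g χ := by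
    simp [LieModule.iSup_genWeightSpace_eq_top' ℂ H g]
  induction hx using LieSubmodule.iSup_induction' with
  | zero => simp
  | add u v _ _ hu hv => exact add_mem hu hv
  | mem χ x hx =>
    by_cases hχ : χ.IsZero
    · rw [hχ.eq] at hx
      exact hH ⟨x, by simpa using hx⟩
    · exact Submodule.subset_span (hroot' χ hχ x hx)

/-- With `κ` the Killing form, `α(t_α) = 4 / κ(α^∨, α^∨)`, and `κ(α^∨, α^∨)` is the sum over the
roots `β` of the squares of the integers `β(α^∨)`, to which `β = α` contributes `4`. So every
squared root length is positive. -/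
lemma maxRootLength_ne_zero : maxRootLength H ≠ 0 := by
  have hpos (α : LieModule.Weight ℂ H g) (hα : α.IsNonZero) :
      0 < (α ((LieAlgebra.IsKilling.cartanEquivDual H).symm
        (LieModule.Weight.toLinear ℂ H g α))).re := by
    set c := α ((LieAlgebra.IsKilling.cartanEquivDual H).symm
        (LieModule.Weight.toLinear ℂ H g α)) with hc
    have hc0 : c ≠ 0 := LieAlgebra.IsKilling.root_apply_cartanEquivDual_symm_ne_zero hα
    have h1 := LieAlgebra.IsKilling.traceForm_coroot α (LieAlgebra.IsKilling.coroot α)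
    rw [LieAlgebra.IsKilling.root_apply_coroot hα, ← hc] at h1
    have h2 : LieModule.traceForm ℂ H g (LieAlgebra.IsKilling.coroot α)
        (LieAlgebra.IsKilling.coroot α) =
        ∑ β ∈ H.root, β (LieAlgebra.IsKilling.coroot α) * β (LieAlgebra.IsKilling.coroot α) := by
      rw [← LieAlgebra.restrict_killingForm, LieAlgebra.IsKilling.restrict_killingForm_eq_sum]
      simp
    have h3 : ∃ m : ℕ, 0 < m ∧
        LieModule.traceForm ℂ H g (LieAlgebra.IsKilling.coroot α)
          (LieAlgebra.IsKilling.coroot α) = m := by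
      have hsq (β : LieModule.Weight ℂ H g) : ∃ m : ℕ,
          β (LieAlgebra.IsKilling.coroot α) * β (LieAlgebra.IsKilling.coroot α) = m := by
        rw [LieAlgebra.IsKilling.apply_coroot_eq_cast]
        generalize (LieModule.chainBotCoeff α β : ℤ) - LieModule.chainTopCoeff α β = k
        refine ⟨k.natAbs * k.natAbs, ?_⟩
        rw [← Int.cast_mul, ← Int.natAbs_mul_self' k]
        simp only [Int.cast_mul, Int.cast_natCast, Nat.cast_mul]
      choose m hm using hsq
      have hα' : α ∈ H.root := by simpa using hα
      refine ⟨∑ β ∈ H.root, m β, ?_, ?_⟩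
      · have : 0 < m α := by
          have := hm α
          rw [LieAlgebra.IsKilling.root_apply_coroot hα] at this
          rcases Nat.eq_zero_or_pos (m α) with h | h
          · rw [h] at this; norm_num at this
          · exact h
        exact this.trans_le (Finset.single_le_sum (f := m) (fun _ _ => Nat.zero_le _) hα')
      · rw [h2, Finset.sum_congr rfl fun β _ => hm β]
        push_cast
        rfl
    obtain ⟨m, hm, hm'⟩ := h3
    rw [hm'] at h1
    have hm0 : (m : ℂ) ≠ 0 := by exact_mod_cast hm.ne'
    have hcm : c = ((4 / m : ℝ) : ℂ) := by
      push_cast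
      rw [eq_div_iff hm0, h1]
      simp only [nsmul_eq_mul, smul_eq_mul]
      push_cast
      field_simp
      norm_num
    rw [hcm, Complex.ofReal_re]
    positivity
  -- Without roots, the spanning lemma applied to the empty set would give `g = 0`.
  have hne : Nonempty H.root := by
    by_contra hc
    rw [not_nonempty_iff] at hc
    have h := span_eq_top_of_rootSpace_subset H (∅ : Set g) (fun α => hc.elim α)
      (fun _ _ _ _ h => h.elim)
    rw [Submodule.span_empty] at h
    have : Subsingleton g := (Submodule.subsingleton_iff ℂ).mp (subsingleton_of_bot_eq_top h)
    exact LieAlgebra.IsSimple.non_abelian ℂ (L := g) ⟨fun a b => Subsingleton.elim _ _⟩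
  obtain ⟨α⟩ := hne
  refine ((hpos α.1 (LieSubalgebra.isNonZero_coe_root α)).trans_le ?_).ne'
  exact le_ciSup (f := fun α : H.root => ((α : LieModule.Weight ℂ H g)
    ((LieAlgebra.IsKilling.cartanEquivDual H).symm
      (LieModule.Weight.toLinear ℂ H g (α : LieModule.Weight ℂ H g)))).re)
    (Set.finite_range _).bddAbove α

lemma exists_normalizedForm_ne_zero : ∃ a b : g, normalizedForm H a b ≠ 0 := by
  by_contra! hc
  have h0 : killingForm ℂ g = 0 := by
    refine LinearMap.ext₂ fun a b => ?_
    have := hc a b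
    simp only [normalizedForm, LinearMap.smul_apply, smul_eq_mul, mul_eq_zero] at this
    refine this.resolve_left ?_
    have := maxRootLength_ne_zero H
    exact_mod_cast div_ne_zero this two_ne_zero
  have hker := LieAlgebra.IsKilling.ker_killingForm_eq_bot ℂ g
  rw [h0, LinearMap.ker_zero] at hker
  have : Subsingleton g := (Submodule.subsingleton_iff ℂ).mp (subsingleton_of_bot_eq_top hker.symm)
  exact LieAlgebra.IsSimple.non_abelian ℂ (L := g) ⟨fun a b => Subsingleton.elim _ _⟩

end SimpleLieAlgebra

/-! ### Common eigenvectors and kernels of commuting operators -/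

section CommutingNilpotent

variable {W : Type*} [AddCommGroup W] [Module ℂ W]

/-- Commuting operators on a nonzero finite-dimensional space have a common eigenvector. -/
lemma exists_common_eigenvector [FiniteDimensional ℂ W] [Nontrivial W]
    (Y : Set (Module.End ℂ W)) (hcomm : ∀ y ∈ Y, ∀ y' ∈ Y, Commute y y') :
    ∃ w ≠ 0, ∀ y ∈ Y, ∃ c : ℂ, y w = c • w := by
  -- On a minimal nonzero stable subspace every `y` is a scalar, since its eigenspaces there are
  -- stable under `Y`.
  let C : Set (Submodule ℂ W) := {V | V ≠ ⊥ ∧ ∀ y ∈ Y, ∀ v ∈ V, y v ∈ V}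
  obtain ⟨V, ⟨hV0, hVY⟩, hmin⟩ := wellFounded_lt.has_min C
    ⟨⊤, top_ne_bot, fun _ _ _ _ => Submodule.mem_top⟩
  obtain ⟨w, hw, hw0⟩ := V.exists_mem_ne_zero_of_ne_bot hV0
  refine ⟨w, hw0, fun y hy => ?_⟩
  have : Nontrivial V := Submodule.nontrivial_iff_ne_bot.mpr hV0
  obtain ⟨c, hc⟩ := Module.End.exists_eigenvalue (y.restrict (hVY y hy))
  obtain ⟨v, hv⟩ := hc.exists_hasEigenvector
  have hv' : y v = c • (v : W) := congrArg Subtype.val hv.apply_eq_smul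
  have hne : V ⊓ Module.End.eigenspace y c ≠ ⊥ := by
    intro h
    have : (v : W) ∈ V ⊓ Module.End.eigenspace y c :=
      ⟨v.2, Module.End.mem_eigenspace_iff.mpr hv'⟩
    rw [h, Submodule.mem_bot] at this
    exact hv.2 (Subtype.ext this)
  have heq : V ⊓ Module.End.eigenspace y c = V := by
    by_contra h
    refine hmin (V ⊓ Module.End.eigenspace y c)
      ⟨hne, fun y' hy' v hv => ⟨hVY y' hy' v hv.1, ?_⟩⟩ (lt_of_le_of_ne inf_le_left h)
    have : y (y' v) = y' (y v) := congrArg (fun f : Module.End ℂ W => f v) (hcomm y hy y' hy').eq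
    rw [SetLike.mem_coe, Module.End.mem_eigenspace_iff, this,
      Module.End.mem_eigenspace_iff.mp hv.2, map_smul]
  exact ⟨c, Module.End.mem_eigenspace_iff.mp (heq.ge hw).2⟩

/-- Commuting nilpotent operators on a nonzero finite-dimensional space have a common kernel. -/
lemma exists_common_kernel [FiniteDimensional ℂ W] [Nontrivial W] (Y : Set (Module.End ℂ W))
    (hnil : ∀ y ∈ Y, IsNilpotent y) (hcomm : ∀ y ∈ Y, ∀ y' ∈ Y, Commute y y') :
    ∃ w ≠ 0, ∀ y ∈ Y, y w = 0 := by
  obtain ⟨w, hw0, hw⟩ := exists_common_eigenvector Y hcomm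
  refine ⟨w, hw0, fun y hy => ?_⟩
  obtain ⟨c, hc⟩ := hw y hy
  obtain ⟨m, hm⟩ := hnil y hy
  have hpow (k : ℕ) : (y ^ k) w = c ^ k • w := by
    induction k with
    | zero => simp
    | succ k ih => rw [pow_succ', Module.End.mul_apply, ih, map_smul, hc, smul_smul, ← pow_succ]
  have h := hpow m
  rw [hm, LinearMap.zero_apply, eq_comm, smul_eq_zero] at h
  rw [hc, eq_zero_of_pow_eq_zero (h.resolve_right hw0), zero_smul]

lemma LocallyNilpotent.isNilpotent [FiniteDimensional ℂ W] {x : Module.End ℂ W}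
    (hx : LocallyNilpotent x) : IsNilpotent x :=
  Module.End.isNilpotent_iff_of_finite.mpr hx

lemma LocallyNilpotent.neg {x : Module.End ℂ W} (hx : LocallyNilpotent x) :
    LocallyNilpotent (-x) := fun w => by
  obtain ⟨k, hk⟩ := hx w
  refine ⟨k, ?_⟩
  rw [neg_pow, Module.End.mul_apply, hk, map_zero]

end CommutingNilpotent

/-! ### Radical ideals of finite codimension as finite sets of points -/

section Points

variable {A : Type*} [CommRing A] [Algebra ℂ A]

/-- The quotient is Artinian and reduced, hence the product of its residue fields; each is finite
over `ℂ` and so equal to `ℂ`. -/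
lemma exists_points (J : Ideal A) [Module.Finite ℂ (A ⧸ J)] (hJ : J.IsRadical) :
    ∃ (s : ℕ) (χ : Fin s → A →ₐ[ℂ] ℂ),
      (∀ f, (∀ j, χ j f = 0) → f ∈ J) ∧ Function.Surjective fun f j => χ j f := by
  have hart : IsArtinianRing (A ⧸ J) := IsArtinianRing.of_finite ℂ (A ⧸ J)
  have hred : IsReduced (A ⧸ J) := (Ideal.isRadical_iff_quotient_reduced J).mp hJ
  have hbij (m : MaximalSpectrum (A ⧸ J)) :
      Function.Bijective (Algebra.ofId ℂ ((A ⧸ J) ⧸ m.asIdeal)) := by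
    have := m.isMaximal
    let := Ideal.Quotient.field m.asIdeal
    exact IsAlgClosed.algebraMap_bijective_of_isIntegral
  let χ' (m : MaximalSpectrum (A ⧸ J)) : A →ₐ[ℂ] ℂ :=
    ((AlgEquiv.ofBijective _ (hbij m)).symm.toAlgHom.comp (Ideal.Quotient.mkₐ ℂ m.asIdeal)).comp
      (Ideal.Quotient.mkₐ ℂ J)
  have hχ' (m) (f : A) : AlgEquiv.ofBijective _ (hbij m) (χ' m f) =
      IsArtinianRing.equivPi (A ⧸ J) (Ideal.Quotient.mk J f) m := by
    simp only [χ', AlgHom.comp_apply]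
    exact AlgEquiv.apply_symm_apply _ _
  have hfin : Finite (MaximalSpectrum (A ⧸ J)) := inferInstance
  obtain ⟨s, ⟨e⟩⟩ := Finite.exists_equiv_fin (MaximalSpectrum (A ⧸ J))
  refine ⟨s, fun j => χ' (e.symm j), fun f hf => ?_, fun c => ?_⟩
  · rw [← Ideal.Quotient.eq_zero_iff_mem]
    apply (IsArtinianRing.equivPi (A ⧸ J)).injective
    rw [map_zero]
    funext m
    have := hf (e m)
    rw [← hχ', ← e.symm_apply_apply m, this, map_zero]
    rfl
  · obtain ⟨q, hq⟩ := (IsArtinianRing.equivPi (A ⧸ J)).surjective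
      fun m => AlgEquiv.ofBijective _ (hbij m) (c (e m))
    obtain ⟨f, rfl⟩ := Ideal.Quotient.mk_surjective q
    refine ⟨f, funext fun j => ?_⟩
    apply (AlgEquiv.ofBijective _ (hbij (e.symm j))).injective
    rw [hχ', hq]
    simp only [e.apply_symm_apply]

/-- A variant with at least one point, given that there is one. -/
lemma exists_points_pos (χ₀ : A →ₐ[ℂ] ℂ) (J : Ideal A) [Module.Finite ℂ (A ⧸ J)]
    (hJ : J.IsRadical) :
    ∃ (s : ℕ) (_ : 0 < s) (χ : Fin s → A →ₐ[ℂ] ℂ),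
      (∀ f, (∀ j, χ j f = 0) → f ∈ J) ∧ Function.Surjective fun f j => χ j f := by
  obtain ⟨s, χ, h1, h2⟩ := exists_points J hJ
  rcases Nat.eq_zero_or_pos s with rfl | hs
  -- No points means `J` is the whole ring. Any one point may then be added; this covers the trivial
  -- module, which needs one tensor factor.
  · refine ⟨1, one_pos, fun _ => χ₀, fun f _ => h1 f fun j => j.elim0, fun c => ?_⟩
    refine ⟨algebraMap ℂ A (c 0), funext fun j => ?_⟩
    rw [Subsingleton.elim j 0]
    simp
  · exact ⟨s, hs, χ, h1, h2⟩

end Points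

/-! ### Irreducible representations of current algebras -/

section CurrentAlgebra

variable {A : Type*} [CommRing A] [Algebra ℂ A] {g : Type*} [LieRing g] [LieAlgebra ℂ g]
  {W : Type v} [AddCommGroup W] [Module ℂ W]

/-- A representation of the current algebra `A ⊗ g`, as a bilinear map. -/
def IsCurrentRep (ρ : A →ₗ[ℂ] g →ₗ[ℂ] Module.End ℂ W) : Prop :=
  ∀ f h a b, ρ (f * h) ⁅a, b⁆ = ρ f a * ρ h b - ρ h b * ρ f a

/-- The ideal of the functions `f` such that `f ⊗ g` acts by zero. -/
def currentAnnihilator [LieAlgebra.IsSimple ℂ g] {ρ : A →ₗ[ℂ] g →ₗ[ℂ] Module.End ℂ W}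
    (hρ : IsCurrentRep ρ) : Ideal A where
  carrier := {f | ρ f = 0}
  add_mem' {f h} hf hh := by
    change ρ (f + h) = 0
    rw [map_add, show ρ f = 0 from hf, show ρ h = 0 from hh, add_zero]
  zero_mem' := map_zero ρ
  smul_mem' h f hf := by
    change ρ (h * f) = 0
    -- As `g` is perfect, it suffices to write `hf ⊗ [a, b]` as the bracket of `h ⊗ a` and `f ⊗ b`.
    refine LinearMap.ext_on (span_lie_eq_top g) ?_
    rintro _ ⟨a, b, rfl⟩
    rw [hρ, show ρ f = 0 from hf]
    simp

variable {ρ : A →ₗ[ℂ] g →ₗ[ℂ] Module.End ℂ W}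

lemma IsCurrentRep.commute_of_mul_mem [LieAlgebra.IsSimple ℂ g] (hρ : IsCurrentRep ρ) {f h : A}
    (hfh : f * h ∈ currentAnnihilator hρ) (a b : g) : Commute (ρ f a) (ρ h b) := by
  have := hρ f h a b
  rw [show ρ (f * h) = 0 from hfh, LinearMap.zero_apply] at this
  exact sub_eq_zero.mp this.symm

lemma IsCurrentRep.commute_self (hρ : IsCurrentRep ρ) (f h : A) (a : g) :
    Commute (ρ f a) (ρ h a) := by
  have := hρ f h a a
  rw [lie_self, map_zero] at this
  exact sub_eq_zero.mp this.symm

variable {G : Type*} {t : G → A}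

/-- Conjugating `x ⊗ e` by `exp(-(1 ⊗ f))` gives `x ⊗ (e + h - f)`: bracketing with `1 ⊗ f` leaves
the coefficient `x` unchanged. -/
lemma IsCurrentRep.locallyNilpotent_sl2 (hρ : IsCurrentRep ρ) {h e f : g} (ht : IsSl2Triple h e f)
    (x : A) (he : LocallyNilpotent (ρ x e)) (hf : LocallyNilpotent (ρ 1 f)) :
    LocallyNilpotent (ρ x (e + h - f)) := by
  have h1 := hρ 1 x f e
  have h2 := hρ 1 x f h
  have h3 := hρ 1 x f f
  rw [one_mul, ← lie_skew, ht.lie_e_f, map_neg] at h1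
  rw [one_mul, ← lie_skew, ht.lie_h_f_nsmul, neg_neg, map_nsmul] at h2
  rw [lie_self, map_zero] at h3
  have := LocallyNilpotent.conj (F := -ρ 1 f) (X := ρ x e) (X₁ := ρ x h) (X₂ := -ρ x f)
    (by
      have h1' : ρ x h = ρ x e * ρ 1 f - ρ 1 f * ρ x e := by rw [← neg_inj, h1, neg_sub]
      rw [h1', neg_mul, mul_neg]; abel)
    (by
      rw [neg_mul, mul_neg, smul_neg, ofNat_smul_eq_nsmul ℂ 2, h2]; abel)
    (by rw [neg_mul_neg, neg_mul_neg]; exact sub_eq_zero.mp h3.symm) hf.neg he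
  rw [map_sub, map_add, sub_eq_add_neg]
  exact this

variable (ρ t) in
/-- The elements `a` of `g` such that every `t n ⊗ a` is locally nilpotent. -/
def nilpotentSet : Set g := {a | ∀ n, LocallyNilpotent (ρ (t n) a)}

/-- Finitely many `t n` span `A` modulo the annihilator and finitely many elements of `nilpotentSet`
span `g`. They must be chosen inside the given spanning sets, as only the products `t n ⊗ a` are
known to be locally nilpotent. -/
lemma IsCurrentRep.finiteDimensional [LieAlgebra.IsSimple ℂ g] [FiniteDimensional ℂ g]
    (hρ : IsCurrentRep ρ)
    (hirr : ∀ N : Submodule ℂ W, (∀ f a, ∀ w ∈ N, ρ f a w ∈ N) → N = ⊥ ∨ N = ⊤)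
    (ht : Submodule.span ℂ (Set.range t) = ⊤)
    (hg : Submodule.span ℂ (nilpotentSet ρ t) = ⊤)
    [Module.Finite ℂ (A ⧸ currentAnnihilator hρ)] : FiniteDimensional ℂ W := by
  classical
  let q : A →ₗ[ℂ] A ⧸ currentAnnihilator hρ := (Ideal.Quotient.mkₐ ℂ _).toLinearMap
  have hq : Function.Surjective q := Ideal.Quotient.mk_surjective
  have htop : Submodule.span ℂ (q '' Set.range t) = ⊤ := by
    rw [← Submodule.map_span, ht, Submodule.map_top, LinearMap.range_eq_top.mpr hq]
  obtain ⟨T, hT, hTs⟩ := (Submodule.fg_span_iff_fg_span_finset_subset _).mp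
    (htop ▸ Module.Finite.fg_top : (Submodule.span ℂ (q '' Set.range t)).FG)
  obtain ⟨S, hS, hSs⟩ := (Submodule.fg_span_iff_fg_span_finset_subset _).mp
    (hg ▸ Module.Finite.fg_top : (Submodule.span ℂ (nilpotentSet ρ t)).FG)
  have hT' : ∀ y : T, ∃ n, q (t n) = y := fun y => by
    obtain ⟨_, ⟨n, rfl⟩, hn⟩ := hT y.2
    exact ⟨n, hn⟩
  choose n hn using hT'
  let x : T × S → Module.End ℂ W := fun p => ρ (t (n p.1)) p.2
  have hx (f : A) (a : g) : ρ f a ∈ Submodule.span ℂ (Set.range x) := by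
    have h1 (y : T) (a : g) : ρ (t (n y)) a ∈ Submodule.span ℂ (Set.range x) := by
      have ha : a ∈ Submodule.span ℂ (S : Set g) := by rw [← hSs, hg]; trivial
      induction ha using Submodule.span_induction with
      | mem a ha => exact Submodule.subset_span ⟨(y, ⟨a, ha⟩), rfl⟩
      | zero => simp
      | add u v _ _ hu hv => rw [map_add]; exact add_mem hu hv
      | smul c u _ hu => rw [map_smul]; exact Submodule.smul_mem _ c hu
    have h2 : q f ∈ Submodule.span ℂ (q '' Set.range fun y => t (n y)) := by
      have : q '' (Set.range fun y => t (n y)) = T := by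
        ext y
        constructor
        · rintro ⟨_, ⟨y, rfl⟩, rfl⟩
          exact (hn y) ▸ y.2
        · intro hy
          exact ⟨_, ⟨⟨y, hy⟩, rfl⟩, hn ⟨y, hy⟩⟩
      rw [this, ← hTs, htop]
      trivial
    rw [← Submodule.map_span] at h2
    obtain ⟨f', hf', hff'⟩ := h2
    have h3 : ρ f' = ρ f := by
      have : f' - f ∈ currentAnnihilator hρ := Ideal.Quotient.eq.mp hff'
      have : ρ (f' - f) = 0 := this
      rwa [map_sub, sub_eq_zero] at this
    rw [← h3]
    clear h3 hff'
    induction hf' using Submodule.span_induction with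
    | mem f' hf' => obtain ⟨y, rfl⟩ := hf'; exact h1 y a
    | zero => simp
    | add u v _ _ hu hv => rw [map_add]; exact add_mem hu hv
    | smul c u _ hu => rw [map_smul]; exact Submodule.smul_mem _ c hu
  refine finiteDimensional_of_locallyNilpotent x (fun p => hS p.2.2 _) (fun p p' => ?_)
    fun N hN => hirr N fun f a w hw => ?_
  · rw [← hρ]
    exact hx _ _
  · have := hx f a
    generalize ρ f a = y at this
    induction this using Submodule.span_induction with
    | mem y hy => obtain ⟨p, rfl⟩ := hy; exact hN p w hw
    | zero => simp
    | add u v _ _ hu hv => exact add_mem hu hv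
    | smul c u _ hu => exact Submodule.smul_mem _ c hu

/-- For fixed `a` the operators `f ⊗ a` commute, so nilpotency passes from the `t n` to their linear
combinations. -/
lemma IsCurrentRep.isNilpotent [FiniteDimensional ℂ W] (hρ : IsCurrentRep ρ)
    (ht : Submodule.span ℂ (Set.range t) = ⊤) {a : g} (ha : a ∈ nilpotentSet ρ t) (f : A) :
    IsNilpotent (ρ f a) := by
  have hf : f ∈ Submodule.span ℂ (Set.range t) := ht ▸ Submodule.mem_top
  induction hf using Submodule.span_induction with
  | mem f hf => obtain ⟨n, rfl⟩ := hf; exact (ha n).isNilpotent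
  | zero => simp
  | add u v _ _ hu hv =>
    rw [map_add, LinearMap.add_apply]
    exact (hρ.commute_self u v a).isNilpotent_add hu hv
  | smul c u _ hu =>
    rw [map_smul, LinearMap.smul_apply]
    exact hu.smul c

/-- Let `f² ∈ J`. The vectors killed by `fA ⊗ g` form a submodule, because `fA ⊗ g` is an ideal of
`A ⊗ g`. It is nonzero: operators from `fA ⊗ g` commute, and those with `a` in `nilpotentSet`, which
spans `g`, are nilpotent. So it is all of `W`. -/
lemma IsCurrentRep.isRadical [LieAlgebra.IsSimple ℂ g] [FiniteDimensional ℂ W] [Nontrivial W]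
    (hρ : IsCurrentRep ρ)
    (hirr : ∀ N : Submodule ℂ W, (∀ f a, ∀ w ∈ N, ρ f a w ∈ N) → N = ⊥ ∨ N = ⊤)
    (ht : Submodule.span ℂ (Set.range t) = ⊤)
    (hg : Submodule.span ℂ (nilpotentSet ρ t) = ⊤) : (currentAnnihilator hρ).IsRadical := by
  refine (Ideal.isRadical_iff_pow_one_lt 2 one_lt_two).mpr fun f hf => ?_
  let N : Submodule ℂ W :=
    { carrier := {w | ∀ h a, ρ (f * h) a w = 0}
      add_mem' := fun {u v} hu hv h a => by rw [map_add, hu, hv, add_zero]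
      zero_mem' := fun h a => map_zero _
      smul_mem' := fun c u hu h a => by rw [map_smul, hu, smul_zero] }
  rcases hirr N fun h' b w hw h a => by
    have := congrArg (fun y : Module.End ℂ W => y w) (hρ (f * h) h' a b)
    simp only [LinearMap.sub_apply, Module.End.mul_apply] at this
    rw [hw h a, map_zero, sub_zero, mul_assoc] at this
    rw [← this]
    exact hw _ _ with hN | hN
  · obtain ⟨w, hw0, hw⟩ := exists_common_kernel
      {y | ∃ h, ∃ a ∈ nilpotentSet ρ t, ρ (f * h) a = y}
      (by
        rintro _ ⟨h, a, ha, rfl⟩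
        exact hρ.isNilpotent ht ha _)
      (by
        rintro _ ⟨h, a, ha, rfl⟩ _ ⟨h', a', ha', rfl⟩
        refine hρ.commute_of_mul_mem ?_ a a'
        rw [show f * h * (f * h') = h * h' * f ^ 2 by ring]
        exact Ideal.mul_mem_left _ _ hf)
    have : w ∈ N := fun h a => by
      have ha : a ∈ Submodule.span ℂ (nilpotentSet ρ t) := hg ▸ Submodule.mem_top
      induction ha using Submodule.span_induction with
      | mem a ha => exact hw _ ⟨h, a, ha, rfl⟩
      | zero => simp
      | add u v _ _ hu hv => rw [map_add, LinearMap.add_apply, hu, hv, add_zero]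
      | smul c u _ hu => rw [map_smul, LinearMap.smul_apply, hu, smul_zero]
    rw [hN, Submodule.mem_bot] at this
    exact absurd this hw0
  · refine LinearMap.ext fun a => LinearMap.ext fun w => ?_
    have : w ∈ N := hN ▸ Submodule.mem_top
    simpa using this 1 a

/-- An irreducible representation of the current algebra `A ⊗ g` which factors through a
finite-dimensional quotient of `A` and for which `t n ⊗ a` is locally nilpotent for sufficiently
many `a` is a tensor product of evaluation representations at distinct points. -/
theorem IsCurrentRep.exists_equiv [LieAlgebra.IsSimple ℂ g] [FiniteDimensional ℂ g] [Nontrivial W]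
    (hρ : IsCurrentRep ρ)
    (hirr : ∀ N : Submodule ℂ W, (∀ f a, ∀ w ∈ N, ρ f a w ∈ N) → N = ⊥ ∨ N = ⊤)
    (ht : Submodule.span ℂ (Set.range t) = ⊤)
    (hg : Submodule.span ℂ (nilpotentSet ρ t) = ⊤)
    [Module.Finite ℂ (A ⧸ currentAnnihilator hρ)] (χ₀ : A →ₐ[ℂ] ℂ) :
    ∃ (s : ℕ) (_ : 0 < s) (χ : Fin s → A →ₐ[ℂ] ℂ) (_ : Function.Injective χ)
      (U : Fin s → Type v) (_ : ∀ j, AddCommGroup (U j)) (_ : ∀ j, Module ℂ (U j))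
      (_ : ∀ j, LieRingModule g (U j)) (_ : ∀ j, LieModule ℂ g (U j)),
      (∀ j, FiniteDimensional ℂ (U j)) ∧ (∀ j, LieModule.IsIrreducible ℂ g (U j)) ∧
      ∃ Φ : (⨂[ℂ] i, U i) ≃ₗ[ℂ] W, ∀ f a x,
        Φ ((∑ j, χ j f • slot U j (LieModule.toEnd ℂ g (U j) a)) x) = ρ f a (Φ x) := by
  have := hρ.finiteDimensional hirr ht hg
  obtain ⟨s, hs, χ, hχJ, hχ⟩ :=
    exists_points_pos χ₀ (currentAnnihilator hρ) (hρ.isRadical hirr ht hg)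
  have hχinj : Function.Injective χ := by
    intro j k hjk
    by_contra hne
    obtain ⟨f, hf⟩ := hχ (Pi.single j 1)
    have h1 := congrFun hf j
    have h2 := congrFun hf k
    simp only [hjk] at h1 h2
    rw [h2, Pi.single_eq_same, Pi.single_eq_of_ne (Ne.symm hne)] at h1
    exact zero_ne_one h1
  -- Modulo the annihilator the `e j` are orthogonal idempotents, and `f` is congruent to `∑ j, χ j
  -- f • e j`. So `a ↦ ρ (e j) a` are commuting representations of `g` which together give all of
  -- `ρ`.
  choose e he using fun j : Fin s => hχ (Pi.single j 1)
  have he' (j k) : χ k (e j) = (Pi.single j 1 : Fin s → ℂ) k := congrFun (he j) k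
  have hρe (f a) : ρ f a = ∑ j, χ j f • ρ (e j) a := by
    have : f - ∑ j, χ j f • e j ∈ currentAnnihilator hρ := hχJ _ fun k => by
      simp [map_sum, he', Pi.single_apply]
    have : ρ (f - ∑ j, χ j f • e j) = 0 := this
    rw [map_sub, sub_eq_zero] at this
    rw [this]
    simp [map_sum, LinearMap.sum_apply]
  obtain ⟨U, i1, i2, i3, i4, h1, h2, Φ, hΦ⟩ := exists_piTensorProduct_equiv (fun j => ρ (e j))
    (fun j a b => by
      rw [← hρ]
      have : e j * e j - e j ∈ currentAnnihilator hρ := hχJ _ fun k => by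
        simp only [map_sub, map_mul, he', Pi.single_apply]
        split_ifs <;> simp
      have : ρ (e j * e j - e j) = 0 := this
      rw [map_sub, sub_eq_zero] at this
      rw [this])
    (fun j k hjk a b => hρ.commute_of_mul_mem (hχJ _ fun l => by
      simp only [map_mul, he', Pi.single_apply]
      split_ifs with h h'
      · exact absurd (h.symm.trans h') hjk
      all_goals simp) a b)
    (fun N hN => hirr N fun f a w hw => by
      rw [hρe, LinearMap.sum_apply]
      exact sum_mem fun j _ => N.smul_mem _ (hN j a w hw))
  refine ⟨s, hs, χ, hχinj, U, i1, i2, i3, i4, h1, h2, Φ, fun f a x => ?_⟩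
  rw [hρe, LinearMap.sum_apply, LinearMap.sum_apply, map_sum]
  refine Finset.sum_congr rfl fun j _ => ?_
  rw [LinearMap.smul_apply, LinearMap.smul_apply, map_smul, hΦ]

end CurrentAlgebra

/-! ### Finite quotients and characters of the Laurent polynomial ring -/

section LaurentPolynomials

variable {r : ℕ}

lemma span_range_single :
    Submodule.span ℂ (Set.range fun n : Idx r => (AddMonoidAlgebra.single n 1 :
      AddMonoidAlgebra ℂ (Idx r))) = ⊤ := by
  simp [← AddMonoidAlgebra.basis_apply]

/-- A quotient of the Laurent polynomial ring in which all variables are algebraic is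
finite-dimensional. -/
lemma finite_quotient (J : Ideal (AddMonoidAlgebra ℂ (Idx r)))
    (p : Fin (r + 1) → Polynomial ℂ) (hp : ∀ i, p i ≠ 0)
    (hJ : ∀ i, Polynomial.aeval (AddMonoidAlgebra.single (Pi.single i 1) 1 :
      AddMonoidAlgebra ℂ (Idx r)) (p i) ∈ J) :
    Module.Finite ℂ (AddMonoidAlgebra ℂ (Idx r) ⧸ J) := by
  let q : AddMonoidAlgebra ℂ (Idx r) →ₐ[ℂ] AddMonoidAlgebra ℂ (Idx r) ⧸ J := Ideal.Quotient.mkₐ ℂ J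
  let t : Multiplicative (Idx r) →* AddMonoidAlgebra ℂ (Idx r) ⧸ J :=
    (q : AddMonoidAlgebra ℂ (Idx r) →* AddMonoidAlgebra ℂ (Idx r) ⧸ J).comp
      (AddMonoidAlgebra.of ℂ (Idx r))
  let u : Multiplicative (Idx r) →* (AddMonoidAlgebra ℂ (Idx r) ⧸ J)ˣ := t.toHomUnits
  have hu (n : Idx r) : (u (Multiplicative.ofAdd n) : AddMonoidAlgebra ℂ (Idx r) ⧸ J) =
      q (AddMonoidAlgebra.single n 1) := rfl
  have halg (i) : IsAlgebraic ℂ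
      (u (Multiplicative.ofAdd (Pi.single i 1)) : AddMonoidAlgebra ℂ (Idx r) ⧸ J) := by
    refine ⟨p i, hp i, ?_⟩
    rw [hu, Polynomial.aeval_algHom_apply]
    exact Ideal.Quotient.eq_zero_iff_mem.mpr (hJ i)
  -- The relations concern only the `tᵢ`; the inverse of an algebraic unit is algebraic, which
  -- covers negative exponents.
  have hinv (i) : IsAlgebraic ℂ
      ((u (Multiplicative.ofAdd (Pi.single i 1)))⁻¹ : (AddMonoidAlgebra ℂ (Idx r) ⧸ J)ˣ).val := by
    let := (u (Multiplicative.ofAdd (Pi.single i 1))).invertible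
    have := (halg i).invOf
    rwa [invOf_units] at this
  have hz (i) (k : ℤ) : IsIntegral ℂ
      ((u (Multiplicative.ofAdd (Pi.single i 1)) ^ k : (AddMonoidAlgebra ℂ (Idx r) ⧸ J)ˣ) :
        AddMonoidAlgebra ℂ (Idx r) ⧸ J) := by
    obtain ⟨m, rfl | rfl⟩ := k.eq_nat_or_neg
    · rw [zpow_natCast, Units.val_pow_eq_pow_val]
      exact (isAlgebraic_iff_isIntegral.mp (halg i)).pow m
    · rw [zpow_neg, zpow_natCast, ← inv_pow, Units.val_pow_eq_pow_val]
      exact (isAlgebraic_iff_isIntegral.mp (hinv i)).pow m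
  have hint (n : Idx r) : IsIntegral ℂ (q (AddMonoidAlgebra.single n 1)) := by
    have : n = ∑ i, n i • Pi.single i (1 : ℤ) := by
      funext j
      simp [Finset.sum_apply, Pi.single_apply]
    rw [← hu, this, ofAdd_sum, map_prod, Units.coe_prod]
    refine IsIntegral.prod _ fun i _ => ?_
    rw [ofAdd_zsmul, map_zpow]
    exact hz i _
  have hI : Algebra.IsIntegral ℂ (AddMonoidAlgebra ℂ (Idx r) ⧸ J) := ⟨fun y => by
    obtain ⟨f, rfl⟩ := Ideal.Quotient.mk_surjective y
    change IsIntegral ℂ (q f)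
    have hf : f ∈ Submodule.span ℂ (Set.range fun n : Idx r => (AddMonoidAlgebra.single n 1 :
      AddMonoidAlgebra ℂ (Idx r))) := span_range_single ▸ Submodule.mem_top
    induction hf using Submodule.span_induction with
    | mem f hf => obtain ⟨n, rfl⟩ := hf; exact hint n
    | zero => rw [map_zero]; exact isIntegral_zero
    | add u v _ _ hu hv => rw [map_add]; exact hu.add hv
    | smul c u _ hu => rw [map_smul]; exact hu.smul c⟩
  have hft : Algebra.FiniteType ℂ (AddMonoidAlgebra ℂ (Idx r)) := inferInstance
  have hft' : Algebra.FiniteType ℂ (AddMonoidAlgebra ℂ (Idx r) ⧸ J) :=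
    hft.of_surjective q Ideal.Quotient.mk_surjective
  exact Algebra.IsIntegral.finite

/-- A character of the Laurent polynomial ring is evaluation at a point. -/
lemma exists_eval_eq (χ : AddMonoidAlgebra ℂ (Idx r) →ₐ[ℂ] ℂ) :
    ∃ z : Fin (r + 1) → ℂˣ, ∀ n, χ (AddMonoidAlgebra.single n 1) = ∏ i, ((z i : ℂ) ^ n i) := by
  let t : Multiplicative (Idx r) →* ℂ :=
    (χ : AddMonoidAlgebra ℂ (Idx r) →* ℂ).comp (AddMonoidAlgebra.of ℂ (Idx r))
  let u : Multiplicative (Idx r) →* ℂˣ := t.toHomUnits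
  have hu (n : Idx r) : (u (Multiplicative.ofAdd n) : ℂ) =
      χ (AddMonoidAlgebra.single n 1) := rfl
  refine ⟨fun i => u (Multiplicative.ofAdd (Pi.single i 1)), fun n => ?_⟩
  have : n = ∑ i, n i • Pi.single i (1 : ℤ) := by
    funext j
    simp [Finset.sum_apply, Pi.single_apply]
  conv_lhs => rw [← hu, this, ofAdd_sum, map_prod, Units.coe_prod]
  refine Finset.prod_congr rfl fun i _ => ?_
  rw [ofAdd_zsmul, map_zpow, Units.val_zpow_eq_zpow_val]

end LaurentPolynomials

/-! ### From the toroidal algebra to the current algebra -/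

section Toroidal

variable {g : Type*} [LieRing g] [LieAlgebra ℂ g] [FiniteDimensional ℂ g]
  [LieAlgebra.IsSimple ℂ g] (H : LieSubalgebra ℂ g) [H.IsCartanSubalgebra] {r : ℕ}

/-- The linear inclusion of the multi-loop algebra in the toroidal algebra. -/
def loopIncl : LieAlgebra.loopAlgebra ℂ (Idx r) g →ₗ[ℂ] Toroidal H r where
  toFun x := LieAlgebra.ofProd (cocycle H r) (x, 0)
  map_add' x y := by simp [← LieAlgebra.of_add]
  map_smul' c x := by simp [← LieAlgebra.of_smul]

lemma loopIncl_monomial (n : Idx r) (a : g) : loopIncl H (monomial n a) = elt H n a := rfl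

lemma exists_eq_loopIncl_add (y : Toroidal H r) : ∃ x c, y = loopIncl H x + centerIncl H c := by
  refine ⟨((LieAlgebra.ofProd (cocycle H r)).symm y).1,
    TrivialLieModule.equiv ℂ _ _ ((LieAlgebra.ofProd (cocycle H r)).symm y).2, ?_⟩
  apply (LieAlgebra.ofProd (cocycle H r)).symm.injective
  refine Prod.ext ?_ ?_
  · exact (add_zero _).symm
  · exact (zero_add _).symm

lemma loopIncl_lie (x y : LieAlgebra.loopAlgebra ℂ (Idx r) g) :
    ⁅loopIncl H x, loopIncl H y⁆ = loopIncl H ⁅x, y⁆ + centerIncl H (cocycleMap H r x y) := by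
  refine (LieAlgebra.bracket_ofTwoCocycle _ _).trans
    (congrArg (LieAlgebra.ofProd (cocycle H r)) (Prod.ext ?_ ?_))
  · exact (add_zero _).symm
  · change (cocycleMap H r x y : Center r) + 0 - 0 = 0 + cocycleMap H r x y
    rw [add_zero, sub_zero, zero_add]

lemma centerIncl_lie (c : Center r) (y : Toroidal H r) : ⁅centerIncl H c, y⁆ = 0 := by
  refine (LieAlgebra.bracket_ofTwoCocycle _ _).trans
    (congrArg (LieAlgebra.ofProd (cocycle H r)) (Prod.ext ?_ ?_))
  · exact zero_lie _
  · change (cocycleMap H r 0 ((LieAlgebra.ofProd (cocycle H r)).symm y).1 : Center r) + 0 - 0 = 0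
    rw [map_zero, LinearMap.zero_apply, add_zero, sub_zero]

lemma elt_lie_elt' (n m : Idx r) (a b : g) :
    ⁅elt H n a, elt H m b⁆ =
      elt H (n + m) ⁅a, b⁆ + normalizedForm H a b • centerIncl H (centralTerm n m) := by
  rw [← loopIncl_monomial, ← loopIncl_monomial, loopIncl_lie, monomial_lie, cocycleMap_tmul,
    map_smul]
  rfl

variable {H} in
lemma toroidal_induction {P : Toroidal H r → Prop} (helt : ∀ n a, P (elt H n a))
    (hcenter : ∀ c, P (centerIncl H c)) (hadd : ∀ x y, P x → P y → P (x + y))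
    (hsmul : ∀ (c : ℂ) x, P x → P (c • x)) (y : Toroidal H r) : P y := by
  obtain ⟨x, c, rfl⟩ := exists_eq_loopIncl_add H y
  refine hadd _ _ ?_ (hcenter c)
  refine loop_induction (P := fun x => P (loopIncl H x)) helt (fun x y hx hy => ?_)
    (fun c x hx => ?_) x
  · rw [map_add]; exact hadd _ _ hx hy
  · rw [map_smul]; exact hsmul c _ hx

section EvalAction

variable {s : ℕ} (U : Fin s → Type*) [∀ j, AddCommGroup (U j)] [∀ j, Module ℂ (U j)]
  [∀ j, LieRingModule g (U j)] [∀ j, LieModule ℂ g (U j)] (z : Fin s → Fin (r + 1) → ℂˣ)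

lemma evalAction_elt (n : Idx r) (a : g) : evalAction U H z (elt H n a) =
    ∑ j, (∏ i, ((z j i : ℂ) ^ n i)) • slot U j (LieModule.toEnd ℂ g (U j) a) :=
  (Finset.sum_congr rfl fun j _ => by rw [evalHom_elt, map_smul, map_smul] :
    ∑ j, slot U j (LieModule.toEnd ℂ g (U j) (evalHom H (z j) (elt H n a))) = _)

lemma evalAction_centerIncl (c : Center r) : evalAction U H z (centerIncl H c) = 0 :=
  (Finset.sum_eq_zero fun j _ => by rw [evalHom_centerIncl, map_zero, map_zero] :
    ∑ j, slot U j (LieModule.toEnd ℂ g (U j) (evalHom H (z j) (centerIncl H c))) = 0)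

end EvalAction

variable {W : Type v} [AddCommGroup W] [Module ℂ W] [LieRingModule (Toroidal H r) W]
  [LieModule ℂ (Toroidal H r) W]

-- The coefficient at `-n - 1` undoes the exponent shift in `genSeries`, so membership in the
-- category becomes a linear recurrence in the direction `i`.
omit [LieModule ℂ (Toroidal H r) W] in
variable {H} in
lemma polyMul_genSeries (p : Polynomial ℂ) (i : Fin (r + 1)) (a : g) (w : W) (n : Idx r) :
    polyMul p i (genSeries H r a w) (-n - 1) =
      p.sum fun k c => c • ⁅elt H (n + Pi.single i (k : ℤ)) a, w⁆ := by
  unfold polyMul genSeries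
  refine Finset.sum_congr rfl fun k _ => ?_
  have : (fun j => -(-n - 1 - Pi.single i (k : ℤ) : Idx r) j - 1) = n + Pi.single i (k : ℤ) := by
    funext j
    simp only [Pi.sub_apply, Pi.neg_apply, Pi.one_apply, Pi.add_apply]
    ring
  dsimp only
  rw [this]

/-- The centre acts by zero on the modules in the category `E_τ`. -/
lemma InCategoryE.centerIncl_lie (hE : InCategoryE H r W) (c : Center r) (w : W) :
    ⁅centerIncl H c, w⁆ = 0 := by
  obtain ⟨p, hp, hE⟩ := hE
  obtain ⟨k₀, hk₀⟩ : ∃ k₀, (p 0).coeff k₀ ≠ 0 := by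
    by_contra! h
    exact hp 0 (Polynomial.ext h)
  obtain ⟨a, b, hab⟩ := exists_normalizedForm_ne_zero H
  have hE' (n : Idx r) (a : g) (w : W) :
      ∑ k ∈ (p 0).support, (p 0).coeff k • ⁅elt H (n + Pi.single 0 (k : ℤ)) a, w⁆ = 0 := by
    have := congrFun (hE 0 a w) (-n - 1)
    rw [polyMul_genSeries] at this
    exact this
  -- In the bracket of the recurrence for `a` with `b(m)`, the loop part is the recurrence for `⁅a,
  -- b⁆` and vanishes; the central part remains, with the nonzero factor `normalizedForm H a b`.
  have h1 (n m : Idx r) (w : W) : ∑ k ∈ (p 0).support,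
      (p 0).coeff k • ⁅centerIncl H (centralTerm (n + Pi.single 0 (k : ℤ)) m), w⁆ = 0 := by
    have h2 : ∑ k ∈ (p 0).support, (p 0).coeff k •
        ⁅⁅elt H (n + Pi.single 0 (k : ℤ)) a, elt H m b⁆, w⁆ = 0 := by
      simp only [lie_lie, smul_sub, Finset.sum_sub_distrib, hE', zero_sub]
      have h3 := congrArg (fun v => ⁅elt H m b, v⁆) (hE' n a w)
      simp only [lie_sum, lie_smul, lie_zero] at h3
      rw [h3, neg_zero]
    simp only [elt_lie_elt', add_lie, smul_lie, smul_add, Finset.sum_add_distrib] at h2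
    have h4 := hE' (n + m) ⁅a, b⁆ w
    simp only [add_right_comm n m] at h4
    rw [h4, zero_add] at h2
    simp only [smul_comm _ (normalizedForm H a b)] at h2
    rw [← Finset.smul_sum] at h2
    exact (smul_eq_zero.mp h2).resolve_left hab
  -- After shifting `n` by `-k₀` in direction `0`, only the term `k = k₀` satisfies the degree
  -- condition of `centralTerm`, and its coefficient is nonzero.
  have h2 (n m : Idx r) (hnm : n 0 + m 0 = 0) (w : W) : ⁅centerIncl H (centralTerm n m), w⁆ = 0 := by
    have h3 := h1 (n - Pi.single 0 (k₀ : ℤ)) m w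
    rw [Finset.sum_eq_single k₀] at h3
    · rw [sub_add_cancel] at h3
      exact (smul_eq_zero.mp h3).resolve_left hk₀
    · intro k _ hk
      have h4 : ¬ ((n - Pi.single 0 (k₀ : ℤ) + Pi.single 0 (k : ℤ) : Idx r) 0 + m 0 = 0) := by
        simp only [Pi.add_apply, Pi.sub_apply, Pi.single_eq_same]
        omega
      have h5 : ¬ ((n - Pi.single 0 (k₀ : ℤ) + Pi.single 0 (k : ℤ) : Idx r) + m = 0) :=
        fun h => h4 (congrFun h 0)
      simp only [centralTerm, if_neg h4, if_neg h5]
      rw [← Prod.zero_eq_mk, map_zero, zero_lie, smul_zero]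
    · intro h
      rw [Polynomial.notMem_support_iff.mp h, zero_smul]
  have hK₀ (l : Fin r → ℤ) (w : W) :
      ⁅centerIncl H ((AddMonoidAlgebra.single l 1, 0) : Center r), w⁆ = 0 := by
    -- Here `n₀ = 1` produces `K₀(l)`, and the `Kᵢ` part is zero since it could occur only for `l =
    -- 0`, where its coefficients vanish.
    have h3 := h2 (Fin.cons 1 l) (Fin.cons (-1) 0) (by simp) w
    have h4 : centralTerm (Fin.cons 1 l : Idx r) (Fin.cons (-1) 0) =
        (AddMonoidAlgebra.single l 1, 0) := by
      refine Prod.ext ?_ ?_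
      · simp [centralTerm]
      · simp only [centralTerm]
        split_ifs with h
        · funext i
          have := congrFun h i.succ
          simpa using this
        · rfl
    rwa [h4] at h3
  have hK (i : Fin r) (w : W) : ⁅centerIncl H ((0, Pi.single i 1) : Center r), w⁆ = 0 := by
    -- Here `n₀ = 0` removes the `K₀` part.
    have h3 := h2 (Fin.cons 0 (Pi.single i 1)) (-Fin.cons 0 (Pi.single i 1)) (by simp) w
    have h4 : centralTerm (Fin.cons 0 (Pi.single i 1) : Idx r) (-Fin.cons 0 (Pi.single i 1)) =
        (0, Pi.single i 1) := by
      refine Prod.ext ?_ ?_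
      · simp [centralTerm]
      · funext j
        rcases eq_or_ne j i with rfl | hj
        · simp [centralTerm]
        · simp [centralTerm, hj]
    rwa [h4] at h3
  let Z : Submodule ℂ (Center r) :=
    { carrier := {c | ∀ w : W, ⁅centerIncl H c, w⁆ = 0}
      add_mem' := fun {c d} hc hd w => by rw [map_add, add_lie, hc w, hd w, add_zero]
      zero_mem' := fun w => by rw [map_zero, zero_lie]
      smul_mem' := fun a c hc w => by rw [map_smul, smul_lie, hc w, smul_zero] }
  have hZ₁ (f : AddMonoidAlgebra ℂ (Fin r → ℤ)) : ((f, 0) : Center r) ∈ Z := by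
    induction f using AddMonoidAlgebra.induction_linear with
    | zero => exact Z.zero_mem
    | add u v hu hv =>
      have : ((u + v, 0) : Center r) = (u, 0) + (v, 0) := by simp
      rw [this]; exact Z.add_mem hu hv
    | single l a =>
      have : ((AddMonoidAlgebra.single l a, 0) : Center r) =
          a • (AddMonoidAlgebra.single l 1, 0) := by simp
      rw [this]; exact Z.smul_mem a (hK₀ l)
  have hZ₂ (x : Fin r → ℂ) : ((0, x) : Center r) ∈ Z := by
    have : ((0, x) : Center r) = ∑ i, x i • ((0, Pi.single i 1) : Center r) := by
      refine Prod.ext ?_ ?_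
      · simp [Prod.fst_sum]
      · funext j
        simp [Prod.snd_sum, Finset.sum_apply, Pi.single_apply]
    rw [this]
    exact sum_mem fun i _ => Z.smul_mem _ (hK i)
  have : c ∈ Z := by
    have : c = (c.1, 0) + (0, c.2) := by simp
    rw [this]
    exact Z.add_mem (hZ₁ _) (hZ₂ _)
  exact this w

variable (r W) in
/-- The action of the multi-loop algebra on a `τ`-module, as a bilinear map. -/
def currentRep : AddMonoidAlgebra ℂ (Idx r) →ₗ[ℂ] g →ₗ[ℂ] Module.End ℂ W :=
  (TensorProduct.mk ℂ (AddMonoidAlgebra ℂ (Idx r)) g).compr₂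
    ((LieModule.toEnd ℂ (Toroidal H r) W : Toroidal H r →ₗ[ℂ] Module.End ℂ W) ∘ₗ loopIncl H)

lemma currentRep_apply (f : AddMonoidAlgebra ℂ (Idx r)) (a : g) (w : W) :
    currentRep H r W f a w = ⁅loopIncl H (f ⊗ₜ a), w⁆ := rfl

lemma currentRep_single (n : Idx r) (a : g) :
    currentRep H r W (AddMonoidAlgebra.single n 1) a = LieModule.toEnd ℂ (Toroidal H r) W (elt H n a) :=
  rfl

variable {H} in
lemma isCurrentRep (hc : ∀ (c : Center r) (w : W), ⁅centerIncl H c, w⁆ = 0) :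
    IsCurrentRep (currentRep H r W) := by
  intro f h a b
  refine LinearMap.ext fun w => ?_
  rw [LinearMap.sub_apply, Module.End.mul_apply, Module.End.mul_apply]
  simp only [currentRep_apply]
  rw [← lie_lie, loopIncl_lie, add_lie, hc, add_zero, LieAlgebra.ExtendScalars.bracket_tmul]

variable {H} in
lemma submodule_eq_bot_or_top [LieModule.IsIrreducible ℂ (Toroidal H r) W]
    (hc : ∀ (c : Center r) (w : W), ⁅centerIncl H c, w⁆ = 0) (N : Submodule ℂ W)
    (hN : ∀ f a, ∀ w ∈ N, currentRep H r W f a w ∈ N) : N = ⊥ ∨ N = ⊤ := by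
  refine irreducible_toEnd (g := Toroidal H r) N ?_
  rintro _ ⟨y, rfl⟩ w hw
  rw [LieModule.toEnd_apply_apply]
  induction y using toroidal_induction with
  | helt n a => exact hN (AddMonoidAlgebra.single n 1) a w hw
  | hcenter c => rw [hc]; exact N.zero_mem
  | hadd x y hx hy => rw [add_lie]; exact N.add_mem hx hy
  | hsmul c x hx => rw [smul_lie]; exact N.smul_mem c hx

variable {H} in
/-- Irreducible integrable modules in the category `E_τ` are evaluation modules. -/
theorem exists_evalModule_equiv [LieModule.IsIrreducible ℂ (Toroidal H r) W]
    (hI : IsIntegrable H r W) (hE : InCategoryE H r W) :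
    ∃ (s : ℕ) (_ : 0 < s) (U : Fin s → Type v)
      (_ : ∀ j, AddCommGroup (U j)) (_ : ∀ j, Module ℂ (U j))
      (_ : ∀ j, LieRingModule g (U j)) (_ : ∀ j, LieModule ℂ g (U j))
      (z : Fin s → Fin (r + 1) → ℂˣ),
      (∀ j, FiniteDimensional ℂ (U j)) ∧ (∀ j, LieModule.IsIrreducible ℂ g (U j)) ∧
      Function.Injective z ∧ Nonempty (W ≃ₗ⁅ℂ, Toroidal H r⁆ EvalModule U z) := by
  have hW := LieModule.nontrivial_of_isIrreducible ℂ (Toroidal H r) W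
  have hc := hE.centerIncl_lie H
  have hρ := isCurrentRep hc
  obtain ⟨p, hp, hpE⟩ := hE
  have hfin : Module.Finite ℂ (AddMonoidAlgebra ℂ (Idx r) ⧸ currentAnnihilator hρ) := by
    refine finite_quotient _ p hp fun i => ?_
    change currentRep H r W _ = 0
    refine LinearMap.ext fun a => LinearMap.ext fun w => ?_
    -- The recurrence at `n = 0` says that `pᵢ(tᵢ) ⊗ a` acts by zero.
    have h := congrFun (hpE i a w) (-0 - 1)
    rw [polyMul_genSeries] at h
    rw [Polynomial.aeval_def, Polynomial.eval₂_eq_sum, Polynomial.sum, map_sum,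
      LinearMap.sum_apply, LinearMap.sum_apply]
    refine Eq.trans (Finset.sum_congr rfl fun k _ => ?_) h
    rw [← Algebra.smul_def, map_smul, AddMonoidAlgebra.single_pow, one_pow, LinearMap.smul_apply,
      LinearMap.smul_apply, currentRep_single, ← Pi.single_smul]
    simp
  have hnil : Submodule.span ℂ (nilpotentSet (currentRep H r W)
      fun n : Idx r => AddMonoidAlgebra.single n 1) = ⊤ := by
    refine span_eq_top_of_rootSpace_subset H _ (fun α x hx n w => hI.2 α x hx n w)
      fun h e f ht he hf n => ?_
    -- The monomial of exponent `0` is the unit, so `hf 0` concerns `1 ⊗ f`.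
    exact hρ.locallyNilpotent_sl2 ht _ (he n) (hf 0)
  obtain ⟨s, hs, χ, hχ, U, i1, i2, i3, i4, h1, h2, Φ, hΦ⟩ :=
    hρ.exists_equiv (submodule_eq_bot_or_top hc) span_range_single hnil
      -- Evaluation at `(1, …, 1)`, an arbitrary choice of spare point.
      (AddMonoidAlgebra.lift ℂ ℂ (Idx r) (monomialEval 1))
  choose z hz using fun j => exists_eval_eq (χ j)
  refine ⟨s, hs, U, i1, i2, i3, i4, z, h1, h2, fun j k hjk => hχ ?_, ⟨?_⟩⟩
  · refine AddMonoidAlgebra.algHom_ext (fun n => ?_) (by ext)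
    rw [hz, hz, hjk]
  · have key (y : Toroidal H r) (x : ⨂[ℂ] i, U i) : Φ (evalAction U H z y x) = ⁅y, Φ x⁆ := by
      induction y using toroidal_induction with
      | helt n a =>
        rw [← LieModule.toEnd_apply_apply ℂ, ← currentRep_single, ← hΦ, evalAction_elt]
        simp only [hz]
      | hcenter c => rw [hc, evalAction_centerIncl, LinearMap.zero_apply, map_zero]
      | hadd x y hx hy => rw [map_add, LinearMap.add_apply, map_add, hx, hy, add_lie]
      | hsmul c x hx => rw [map_smul, LinearMap.smul_apply, map_smul, hx, smul_lie]
    exact LieModuleEquiv.symm { Φ with map_lie' := fun {y x} => key y x }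

end Toroidal

/-! ### Weight space decomposition -/

section Cartan

variable {g : Type*} [LieRing g] [LieAlgebra ℂ g] [FiniteDimensional ℂ g]
  [LieAlgebra.IsSimple ℂ g] (H : LieSubalgebra ℂ g) [H.IsCartanSubalgebra] {r : ℕ}

lemma elt_add (n : Idx r) (a b : g) : elt H n (a + b) = elt H n a + elt H n b := by
  rw [← loopIncl_monomial, ← loopIncl_monomial, ← loopIncl_monomial, ← map_add]
  exact congrArg _ (TensorProduct.tmul_add _ _ _)

lemma elt_smul (n : Idx r) (c : ℂ) (a : g) : elt H n (c • a) = c • elt H n a := by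
  rw [← loopIncl_monomial, ← loopIncl_monomial, ← map_smul]
  exact congrArg _ (TensorProduct.tmul_smul _ _ _)

lemma elt_zero (n : Idx r) : elt H n (0 : g) = 0 := by
  simpa using elt_smul H n 0 (0 : g)

lemma exists_eq_elt_add_of_mem_extCartan {x : Toroidal H r} (hx : x ∈ extCartan H r) :
    ∃ h ∈ H, ∃ c, x = elt H 0 h + centerIncl H c := by
  induction hx using Submodule.span_induction with
  | mem x hx =>
    rcases hx with (⟨h, hh, rfl⟩ | ⟨n, rfl⟩) | ⟨i, rfl⟩
    · exact ⟨h, hh, 0, by rw [map_zero, add_zero]⟩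
    · exact ⟨0, H.zero_mem, _, by rw [elt_zero, zero_add]; rfl⟩
    · exact ⟨0, H.zero_mem, _, by rw [elt_zero, zero_add]; rfl⟩
  | zero => exact ⟨0, H.zero_mem, 0, by rw [map_zero, add_zero, elt_zero]⟩
  | add x y _ _ hx hy =>
    obtain ⟨h, hh, c, rfl⟩ := hx
    obtain ⟨k, hk, d, rfl⟩ := hy
    exact ⟨h + k, H.add_mem hh hk, c + d, by rw [elt_add, map_add]; abel⟩
  | smul a x _ hx =>
    obtain ⟨h, hh, c, rfl⟩ := hx
    exact ⟨a • h, H.smul_mem a hh, a • c, by rw [elt_smul, map_smul, smul_add]⟩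

variable (W : Type*) [AddCommGroup W] [Module ℂ W] [LieRingModule (Toroidal H r) W]
  [LieModule ℂ (Toroidal H r) W]

variable {H W} in
lemma commute_extCartan (hc : ∀ (c : Center r) (w : W), ⁅centerIncl H c, w⁆ = 0)
    (x y : extCartan H r) : Commute (LieModule.toEnd ℂ (Toroidal H r) W x)
      (LieModule.toEnd ℂ (Toroidal H r) W y) := by
  obtain ⟨h, hh, c, hx⟩ := exists_eq_elt_add_of_mem_extCartan H x.2
  obtain ⟨k, hk, d, hy⟩ := exists_eq_elt_add_of_mem_extCartan H y.2
  have hhk : ⁅h, k⁆ = 0 := congrArg Subtype.val (trivial_lie_zero H H ⟨h, hh⟩ ⟨k, hk⟩)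
  refine LinearMap.ext fun w => ?_
  simp only [Module.End.mul_apply, LieModule.toEnd_apply_apply, hx, hy, add_lie, hc, add_zero]
  rw [← sub_eq_zero, ← lie_lie, elt_lie_elt', hhk, elt_zero, zero_add, smul_lie, hc, smul_zero]

-- Weight spaces lie in the simultaneous generalized eigenspaces of a commuting family, and these
-- are independent.
variable {H} in
lemma iSupIndep_weightSpace (hc : ∀ (c : Center r) (w : W), ⁅centerIncl H c, w⁆ = 0) :
    iSupIndep (weightSpace H r W) := by
  have h := Module.End.independent_iInf_maxGenEigenspace_of_forall_mapsTo
    (fun x : extCartan H r => LieModule.toEnd ℂ (Toroidal H r) W x)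
    fun x y φ => Module.End.mapsTo_maxGenEigenspace_of_comm (commute_extCartan hc y x) φ
  have h' := h.comp (f := fun lam : Module.Dual ℂ (extCartan H r) => (lam : extCartan H r → ℂ))
    DFunLike.coe_injective
  refine h'.mono fun lam w hw => ?_
  refine (Submodule.mem_iInf _).mpr fun x => ?_
  refine (Module.End.mem_maxGenEigenspace _ _ _).mpr ⟨1, ?_⟩
  rw [pow_one, LinearMap.sub_apply, LinearMap.smul_apply, Module.End.one_apply,
    LieModule.toEnd_apply_apply]
  exact sub_eq_zero.mpr (hw x)

-- On a nonzero common eigenvector the eigenvalues depend linearly on the operator, so they form a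
-- weight.
variable {H W} in
lemma mem_iSup_weightSpace {w : W}
    (hw : ∀ x : extCartan H r, ∃ c : ℂ, ⁅(x : Toroidal H r), w⁆ = c • w) :
    w ∈ ⨆ lam, weightSpace H r W lam := by
  rcases eq_or_ne w 0 with rfl | hw0
  · exact Submodule.zero_mem _
  choose c hc using hw
  let lam : Module.Dual ℂ (extCartan H r) :=
    { toFun := c
      map_add' := fun x y => smul_left_injective ℂ hw0 (by
        change c (x + y) • w = (c x + c y) • w
        rw [add_smul, ← hc, ← hc, ← hc, ← add_lie]; rfl)
      map_smul' := fun a x => smul_left_injective ℂ hw0 (by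
        change c (a • x) • w = (a * c x) • w
        rw [mul_smul, ← hc, ← hc, ← smul_lie]; rfl) }
  exact Submodule.mem_iSup_of_mem lam hc

-- The sum of the weight spaces is a submodule, as root vectors shift weights, and it is nonzero, as
-- commuting operators have a common eigenvector. Irreducibility then finishes, without any
-- diagonalization on the single factors.
variable {H} in
lemma iSup_weightSpace_eq_top [FiniteDimensional ℂ W]
    [LieModule.IsIrreducible ℂ (Toroidal H r) W]
    (hc : ∀ (c : Center r) (w : W), ⁅centerIncl H c, w⁆ = 0) :
    ⨆ lam, weightSpace H r W lam = ⊤ := by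
  have hW := LieModule.nontrivial_of_isIrreducible ℂ (Toroidal H r) W
  set T : Submodule ℂ W := ⨆ lam, weightSpace H r W lam
  have hroot (χ : LieModule.Weight ℂ H g) (a : g)
      (ha : a ∈ LieModule.genWeightSpace g (χ : H → ℂ)) (n : Idx r) (w : W) (hw : w ∈ T) :
      ⁅elt H n a, w⁆ ∈ T := by
    refine Submodule.iSup_induction _ (motive := fun w : W => ⁅elt H n a, w⁆ ∈ T) hw
      (fun lam w hw => mem_iSup_weightSpace (H := H) (r := r) fun x => ?_) ?_ fun v w hv hw => ?_
    · obtain ⟨h, hh, c, hx⟩ := exists_eq_elt_add_of_mem_extCartan H x.2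
      refine ⟨χ ⟨h, hh⟩ + lam x, ?_⟩
      have h1 : ⁅h, a⁆ = χ ⟨h, hh⟩ • a :=
        LieAlgebra.IsKilling.lie_eq_smul_of_mem_rootSpace ha ⟨h, hh⟩
      have h2 : ⁅elt H (0 : Idx r) h, w⁆ = lam x • w := by
        rw [← hw x, hx, add_lie, hc, add_zero]
      rw [hx, add_lie, hc, add_zero, leibniz_lie, h2, elt_lie_elt', h1, zero_add, add_lie,
        smul_lie, hc, smul_zero, add_zero, elt_smul, smul_lie, lie_smul, add_smul]
    · rw [lie_zero]; exact T.zero_mem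
    · rw [lie_add]; exact T.add_mem hv hw
  have helt (a : g) (n : Idx r) (w : W) (hw : w ∈ T) : ⁅elt H n a, w⁆ ∈ T := by
    have ha : a ∈ (⨆ χ : LieModule.Weight ℂ H g, LieModule.genWeightSpace g (χ : H → ℂ) :
        LieSubmodule ℂ H g).toSubmodule := by
      rw [LieModule.iSup_genWeightSpace_eq_top' ℂ H g]
      exact Submodule.mem_top
    rw [LieSubmodule.iSup_toSubmodule] at ha
    refine Submodule.iSup_induction _ (motive := fun a => ⁅elt H n a, w⁆ ∈ T) ha
      (fun χ a ha => hroot χ a ha n w hw) ?_ fun a b ha hb => ?_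
    · rw [elt_zero, zero_lie]; exact T.zero_mem
    · rw [elt_add, add_lie]; exact T.add_mem ha hb
  have hirr : T = ⊥ ∨ T = ⊤ := by
    refine irreducible_toEnd (g := Toroidal H r) T ?_
    rintro _ ⟨y, rfl⟩ w hw
    rw [LieModule.toEnd_apply_apply]
    induction y using toroidal_induction with
    | helt n a => exact helt a n w hw
    | hcenter c => rw [hc]; exact T.zero_mem
    | hadd x y hx hy => rw [add_lie]; exact T.add_mem hx hy
    | hsmul c x hx => rw [smul_lie]; exact T.smul_mem c hx
  refine hirr.resolve_left fun h => ?_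
  obtain ⟨w, hw, hY⟩ := exists_common_eigenvector
    (Set.range fun x : extCartan H r => LieModule.toEnd ℂ (Toroidal H r) W x) (by
      rintro _ ⟨x, rfl⟩ _ ⟨y, rfl⟩; exact commute_extCartan hc x y)
  refine hw ((Submodule.mem_bot ℂ).mp (h ▸ mem_iSup_weightSpace fun x => ?_))
  exact hY _ ⟨x, rfl⟩

end Cartan

/-! ### Evaluation modules at distinct points -/

section EvalModule

variable {g : Type*} [LieRing g] [LieAlgebra ℂ g] [FiniteDimensional ℂ g]
  [LieAlgebra.IsSimple ℂ g] (H : LieSubalgebra ℂ g) [H.IsCartanSubalgebra] {r : ℕ}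
  {s : ℕ} (U : Fin s → Type*) [∀ j, AddCommGroup (U j)] [∀ j, Module ℂ (U j)]
  [∀ j, LieRingModule g (U j)] [∀ j, LieModule ℂ g (U j)] (z : Fin s → Fin (r + 1) → ℂˣ)

lemma monomialEval_injective :
    Function.Injective (monomialEval : (Fin (r + 1) → ℂˣ) → Multiplicative (Idx r) →* ℂ) := by
  intro z w h
  funext i
  have key (z : Fin (r + 1) → ℂˣ) :
      monomialEval z (Multiplicative.ofAdd (Pi.single i 1 : Idx r)) = z i := by
    change ∏ k, ((z k : ℂ) ^ (Pi.single i 1 : Idx r) k) = z i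
    rw [Finset.prod_eq_single i]
    · simp
    · intro k _ hk; simp [hk]
    · simp
  apply Units.ext
  rw [← key z, ← key w, h]

variable {z} in
/-- The values of the monomials at distinct points span the space of functions on these points. -/
lemma span_monomialEval_eq_top (hz : Function.Injective z) :
    Submodule.span ℂ (Set.range fun (n : Multiplicative (Idx r)) (k : Fin s) =>
      monomialEval (z k) n) = ⊤ :=
  -- Dedekind's independence of characters, transposed: independent rows of the matrix of values
  -- mean spanning columns.
  span_flip_eq_top_iff_linearIndependent.mpr
    ((linearIndependent_monoidHom (Multiplicative (Idx r)) ℂ).comp _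
      (monomialEval_injective.comp hz))

-- The coefficient vectors `c` for which `∑ k, c k • slot k a` sends `x` into `N` form a subspace.
-- It contains the values of every monomial at the points, hence every vector, in particular the
-- `j`-th unit vector.
variable {U z} in
lemma slot_mem_of_evalAction_mem (hz : Function.Injective z) (N : Submodule ℂ (⨂[ℂ] i, U i))
    (hN : ∀ n a, ∀ x ∈ N, evalAction U H z (elt H n a) x ∈ N) (j : Fin s) (a : g)
    {x : ⨂[ℂ] i, U i} (hx : x ∈ N) : slot U j (LieModule.toEnd ℂ g (U j) a) x ∈ N := by
  let L : (Fin s → ℂ) →ₗ[ℂ] ⨂[ℂ] i, U i :=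
    Fintype.linearCombination ℂ fun k => slot U k (LieModule.toEnd ℂ g (U k) a) x
  have hL : ⊤ ≤ N.comap L := by
    rw [← span_monomialEval_eq_top hz, Submodule.span_le]
    rintro _ ⟨n, rfl⟩
    have := hN n.toAdd a x hx
    rw [evalAction_elt, LinearMap.sum_apply] at this
    exact this
  have := hL (Submodule.mem_top : Pi.single j 1 ∈ _)
  rw [Submodule.mem_comap, Fintype.linearCombination_apply_single, one_smul] at this
  exact this

variable {z} in
lemma evalAction_irreducible [∀ j, FiniteDimensional ℂ (U j)]
    [∀ j, LieModule.IsIrreducible ℂ g (U j)] (hz : Function.Injective z)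
    (N : Submodule ℂ (⨂[ℂ] i, U i))
    (hN : ∀ n a, ∀ x ∈ N, evalAction U H z (elt H n a) x ∈ N) : N = ⊥ ∨ N = ⊤ := by
  have hU (j : Fin s) : Nontrivial (U j) := LieModule.nontrivial_of_isIrreducible ℂ g (U j)
  refine piTensorProduct_irreducible U (fun j => Set.range (LieModule.toEnd ℂ g (U j)))
    (fun j => irreducible_toEnd) N ?_
  rintro j _ ⟨a, rfl⟩ x hx
  exact slot_mem_of_evalAction_mem H hz N hN j a hx

lemma finiteDimensional_nontrivial_piTensorProduct [∀ j, FiniteDimensional ℂ (U j)]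
    [∀ j, Nontrivial (U j)] :
    FiniteDimensional ℂ (⨂[ℂ] i, U i) ∧ Nontrivial (⨂[ℂ] i, U i) := by
  let b := Basis.piTensorProduct fun j => Module.finBasis ℂ (U j)
  have hne (j : Fin s) : Nonempty (Fin (Module.finrank ℂ (U j))) := ⟨⟨0, Module.finrank_pos⟩⟩
  exact ⟨b.finiteDimensional_of_finite, ⟨⟨b fun j => Classical.arbitrary _, 0, b.ne_zero _⟩⟩⟩

/-- The operator is a sum of commuting nilpotent operators, one in each slot. -/
lemma isNilpotent_evalAction [∀ j, FiniteDimensional ℂ (U j)] (n : Idx r) {a : g}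
    (ha : ∀ j, IsNilpotent (LieModule.toEnd ℂ g (U j) a)) :
    IsNilpotent (evalAction U H z (elt H n a)) := by
  rw [evalAction_elt]
  have hs (j : Fin s) (k : ℕ) (f : Module.End ℂ (U j)) : slot U j (f ^ k) = slot U j f ^ k := by
    induction k with
    | zero => rw [pow_zero, pow_zero, slot_one]
    | succ k ih => rw [pow_succ, pow_succ, slot_mul, ih]
  refine Commute.isNilpotent_sum (fun j _ => ?_) fun j k _ _ => ?_
  · obtain ⟨m, hm⟩ := ha j
    refine IsNilpotent.smul (⟨m, ?_⟩ : IsNilpotent (slot U j (LieModule.toEnd ℂ g (U j) a))) _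
    rw [← hs, hm, map_zero]
  · rcases eq_or_ne j k with rfl | h
    · exact Commute.refl _
    · exact ((show Commute _ _ from slot_commute U h _ _).smul_left _).smul_right _

end EvalModule

/-! ### Evaluation modules are irreducible, integrable and in the category -/

section Equivalence

variable {g : Type*} [LieRing g] [LieAlgebra ℂ g] [FiniteDimensional ℂ g]
  [LieAlgebra.IsSimple ℂ g] {H : LieSubalgebra ℂ g} [H.IsCartanSubalgebra] {r : ℕ}
  {s : ℕ} {U : Fin s → Type*} [∀ j, AddCommGroup (U j)] [∀ j, Module ℂ (U j)]
  [∀ j, LieRingModule g (U j)] [∀ j, LieModule ℂ g (U j)] {z : Fin s → Fin (r + 1) → ℂˣ}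
  {W : Type*} [AddCommGroup W] [Module ℂ W] [LieRingModule (Toroidal H r) W]
  [LieModule ℂ (Toroidal H r) W]

omit [LieModule ℂ (Toroidal H r) W] in
lemma exists_linearEquiv (Φ : W ≃ₗ⁅ℂ, Toroidal H r⁆ EvalModule U z) :
    ∃ e : W ≃ₗ[ℂ] ⨂[ℂ] i, U i, ∀ (y : Toroidal H r) (w : W),
      e ⁅y, w⁆ = evalAction U H z y (e w) :=
  ⟨Φ.toLinearEquiv, fun y w =>
    LieModuleHom.map_lie (Φ : W →ₗ⁅ℂ, Toroidal H r⁆ EvalModule U z) y w⟩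

omit [LieModule ℂ (Toroidal H r) W] in
lemma isIrreducible_of_evalModule_equiv (Φ : W ≃ₗ⁅ℂ, Toroidal H r⁆ EvalModule U z)
    [∀ j, FiniteDimensional ℂ (U j)] [∀ j, LieModule.IsIrreducible ℂ g (U j)]
    (hz : Function.Injective z) : LieModule.IsIrreducible ℂ (Toroidal H r) W := by
  have hU (j : Fin s) : Nontrivial (U j) := LieModule.nontrivial_of_isIrreducible ℂ g (U j)
  have hn : Nontrivial (⨂[ℂ] i, U i) := (finiteDimensional_nontrivial_piTensorProduct U).2
  obtain ⟨e, he⟩ := exists_linearEquiv Φ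
  have hW : Nontrivial W := e.toEquiv.nontrivial
  refine LieModule.IsIrreducible.mk fun N hN => ?_
  have h := evalAction_irreducible H U hz (N.toSubmodule.map (e : W →ₗ[ℂ] ⨂[ℂ] i, U i)) ?_
  · rw [Submodule.map_eq_bot_iff, Submodule.map_eq_top_iff,
      LieSubmodule.toSubmodule_eq_bot, LieSubmodule.toSubmodule_eq_top] at h
    exact h.resolve_left hN
  · rintro n a _ ⟨w, hw, rfl⟩
    exact ⟨_, N.lie_mem hw, he (elt H n a) w⟩

lemma isIntegrable_of_evalModule_equiv (Φ : W ≃ₗ⁅ℂ, Toroidal H r⁆ EvalModule U z)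
    [∀ j, FiniteDimensional ℂ (U j)] [∀ j, LieModule.IsIrreducible ℂ g (U j)]
    (hz : Function.Injective z) : IsIntegrable H r W := by
  classical
  have := isIrreducible_of_evalModule_equiv Φ hz
  have hU (j : Fin s) : Nontrivial (U j) := LieModule.nontrivial_of_isIrreducible ℂ g (U j)
  have hf : FiniteDimensional ℂ (⨂[ℂ] i, U i) := (finiteDimensional_nontrivial_piTensorProduct U).1
  obtain ⟨e, he⟩ := exists_linearEquiv Φ
  have hfW : FiniteDimensional ℂ W := e.symm.finiteDimensional
  have hc (c : Center r) (w : W) : ⁅centerIncl H c, w⁆ = 0 := by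
    apply e.injective
    rw [he, evalAction_centerIncl, LinearMap.zero_apply, map_zero]
  refine ⟨?_, fun α x hx n w => ?_⟩
  · rw [DirectSum.isInternal_submodule_iff_iSupIndep_and_iSup_eq_top]
    exact ⟨iSupIndep_weightSpace W hc, iSup_weightSpace_eq_top W hc⟩
  · have hα : (α : LieModule.Weight ℂ H g).IsNonZero := (Finset.mem_filter.mp α.2).2
    -- An element of a nonzero root space acts nilpotently on every finite-dimensional `g`-module.
    obtain ⟨k, hk⟩ := isNilpotent_evalAction H U z n (a := x) fun j =>
      LieModule.isNilpotent_toEnd_of_mem_rootSpace (U j) H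
        (fun h => hα h) hx
    refine ⟨k, e.injective ?_⟩
    have (k : ℕ) (w : W) : e ((LieModule.toEnd ℂ (Toroidal H r) W (elt H n x) ^ k) w) =
        (evalAction U H z (elt H n x) ^ k) (e w) := by
      induction k with
      | zero => rfl
      | succ k ih =>
        rw [pow_succ', pow_succ', Module.End.mul_apply, Module.End.mul_apply, ← ih]
        exact he _ _
    rw [this, hk, LinearMap.zero_apply, map_zero]

omit [LieModule ℂ (Toroidal H r) W] in
lemma inCategoryE_of_evalModule_equiv (Φ : W ≃ₗ⁅ℂ, Toroidal H r⁆ EvalModule U z) :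
    InCategoryE H r W := by
  obtain ⟨e, he⟩ := exists_linearEquiv Φ
  -- The `i`-th polynomial vanishes at the `i`-th coordinates of all the points. In slot `j` the
  -- recurrence multiplies the action by its value at `z j i`, which is zero.
  refine ⟨fun i => ∏ j, (Polynomial.X - Polynomial.C (z j i : ℂ)), fun i =>
    (Polynomial.monic_prod_of_monic _ _ fun j _ => Polynomial.monic_X_sub_C _).ne_zero,
    fun i a w => funext fun d => ?_⟩
  set p : Polynomial ℂ := ∏ j, (Polynomial.X - Polynomial.C (z j i : ℂ)) with hp
  have hroot (j : Fin s) : p.eval (z j i : ℂ) = 0 := by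
    rw [hp, Polynomial.eval_prod]
    exact Finset.prod_eq_zero (Finset.mem_univ j) (by simp)
  obtain ⟨n, rfl⟩ : ∃ n : Idx r, d = -n - 1 := ⟨-d - 1, by abel⟩
  rw [polyMul_genSeries]
  apply e.injective
  have hmon (j : Fin s) (k : ℕ) : ∏ l, ((z j l : ℂ) ^ (n + Pi.single i (k : ℤ) : Idx r) l) =
      (∏ l, ((z j l : ℂ) ^ n l)) * (z j i : ℂ) ^ k := by
    simp only [Pi.add_apply, zpow_add₀ (Units.ne_zero _), Finset.prod_mul_distrib]
    congr 1
    rw [Finset.prod_eq_single i]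
    · simp
    · intro l _ hl; simp [hl]
    · simp
  have h (k : ℕ) : e ⁅elt H (n + Pi.single i (k : ℤ)) a, w⁆ =
      ∑ j, ((z j i : ℂ) ^ k) • (∏ l, ((z j l : ℂ) ^ n l)) •
        slot U j (LieModule.toEnd ℂ g (U j) a) (e w) := by
    rw [he, evalAction_elt, LinearMap.sum_apply]
    refine Finset.sum_congr rfl fun j _ => ?_
    rw [hmon, mul_comm, mul_smul]
    rfl
  rw [Polynomial.sum, map_sum]
  simp only [map_smul, h, Finset.smul_sum]
  rw [Finset.sum_comm]
  simp only [smul_smul _ _ ((_ : ℂ) • _), ← Finset.sum_smul]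
  refine Eq.trans (Finset.sum_eq_zero fun j _ => ?_) (map_zero e).symm
  have : ∑ k ∈ p.support, p.coeff k * (z j i : ℂ) ^ k = 0 := by
    rw [← hroot j, Polynomial.eval_eq_sum, Polynomial.sum]
  rw [this, zero_smul]

end Equivalence

end ToroidalLie

end

theorem proposition3p5
    {g : Type*} [LieRing g] [LieAlgebra ℂ g] [FiniteDimensional ℂ g] [LieAlgebra.IsSimple ℂ g]
    (H : LieSubalgebra ℂ g) [H.IsCartanSubalgebra]
    (r : ℕ) (hr : 0 < r)
    (W : Type v) [AddCommGroup W] [Module ℂ W]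
    [LieRingModule (ToroidalLie.Toroidal H r) W] [LieModule ℂ (ToroidalLie.Toroidal H r) W] :
    (LieModule.IsIrreducible ℂ (ToroidalLie.Toroidal H r) W ∧ ToroidalLie.IsIntegrable H r W ∧ ToroidalLie.InCategoryE H r W) ↔
      ∃ (s : ℕ) (_ : 0 < s) (U : Fin s → Type v)
        (_ : ∀ j, AddCommGroup (U j)) (_ : ∀ j, Module ℂ (U j))
        (_ : ∀ j, LieRingModule g (U j)) (_ : ∀ j, LieModule ℂ g (U j))
        (z : Fin s → Fin (r + 1) → ℂˣ),
        (∀ j, FiniteDimensional ℂ (U j)) ∧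
        (∀ j, LieModule.IsIrreducible ℂ g (U j)) ∧
        Function.Injective z ∧
        Nonempty (W ≃ₗ⁅ℂ, ToroidalLie.Toroidal H r⁆ ToroidalLie.EvalModule U z) := by
  constructor
  · rintro ⟨hirr, hI, hE⟩
    exact ToroidalLie.exists_evalModule_equiv hI hE
  · rintro ⟨s, hs, U, i1, i2, i3, i4, z, hfd, hirr, hz, ⟨Φ⟩⟩
    exact ⟨ToroidalLie.isIrreducible_of_evalModule_equiv Φ hz,
      ToroidalLie.isIntegrable_of_evalModule_equiv Φ hz,
      ToroidalLie.inCategoryE_of_evalModule_equiv Φ⟩
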